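/- Let $m\ge 2$, let $X\subset\mathbb R^m$ be a bounded, connected, nonempty open set, and let $Y=(a,b)\subset\mathbb R$ be a bounded open interval. For an open set $\Omega$ we write $f\in C^r(\overline\Omega)$ if $f\in C^r(\Omega)$ and $f$ and all its derivatives of order at most $r$ extend continuously to $\overline\Omega$; derivatives in $y$ at $a$ and $b$ are one-sided. Let $r\ge 2$ be an integer, and let $c\in C^r(\overline X\times\overline Y)$, $V\in C^r(\overline Y)$, $W\in C^r(\overline Y\times\overline Y)$ with $W(y,z)=W(z,y)$. Assume: * (twist and non-degeneracy) for every $x\in X$ the map $y\mapsto D_xc(x,y)$ is injective on $Y$, and $D_x\partial_yc(x,y)\neq0$ for all $(x,y)\in X\times\overline Y$; * (uniform convexity) there is $C>0$ with $\partial^2_{yy}c(x,y)+V''(y)+\partial^2_{yy}W(y,z)\ge C$ for all $x\in X$ and $y,z\in Y$; * (outward gradient) for all $x\in X$ and $z\in Y$, the quantity $\partial_yc(x,y)+V'(y)+\partial_yW(y,z)$ is $\ge0$ at $y=b$ and $\le0$ at $y=a$; * $g:[0,\infty)\to\mathbb R$ is strictly convex, continuously differentiable on $(0,\infty)$, with $g(t)/t\to\infty$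 as $t\to\infty$ and $g'(t)\to-\infty$ as $t\to0^+$. Let $\mathcal T_c(\mu,\nu)$ be the optimal transport cost, i.e. the infimum of $\int c\,d\gamma$ over couplings $\gamma$ of $\mu$ and $\nu$. Let $\mathcal G(\mu)=\int_Xg(\bar\mu)\,dx$ if $\mu$ has a density $\bar\mu$ with respect to Lebesgue measure on $X$, and $\mathcal G(\mu)=+\infty$ otherwise. Suppose that $(\mu,\nu)\in\mathcal P(\overline X)\times\mathcal P(\overline Y)$ minimizes $$\mathcal T_c(\mu,\nu)+\mathcal G(\mu)+\int V\,d\nu+\frac12\iint W(y,z)\,d\nu(z)\,d\nu(y)$$ over $\mathcal P(\overline X)\times\mathcal P(\overline Y)$. A pair of Kantorovich potentials is a maximizer $(u,v)$ of the dual problem $\sup\{\int u\,d\mu+\int v\,d\nu:\ u(x)+v(y)\le c(x,y)\text{ on }\overline X\times\overline Y\}$, over integrable $u$ and $v$, such that $u(x)=\min_{y\in\overline Y}[c(x,y)-v(y)]$ and $v(y)=\min_{x\in\overline X}[c(x,y)-u(x)]$. Then: 1. $(c,\mu,\nu)$ is nested: with $X_\ge(y,k)=\{x\in X:\partial_yc(x,y)\ge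 k\}$, and $X_>(y,k)$, $X_=(y,k)$ defined likewise with $>$ and $=$, for every $y\in Y$ there is a $k(y)$ with $\mu(X_\ge(y,k(y)))=\nu((-\infty,y])$, and for any choice of such levels, $X_\ge(y_0,k(y_0))\subseteq X_>(y_1,k(y_1))$ whenever $y_0<y_1$ in $Y$ and $\nu([y_0,y_1])>0$. Moreover, Kantorovich potentials $(u,v)$ exist, and every such pair satisfies the generalized nestedness condition: for $\nu$-almost every $y$, $v$ is differentiable at $y$ and $\{x\in X:u(x)+v(y)=c(x,y)\}=X_=(y,v'(y))$. 2. $\mu$ is absolutely continuous with respect to Lebesgue measure on $X$, and it has a continuous density $\bar\mu$ that is positive at every point of $X$. 3. There is an optimal map $T:X\to\overline Y$ from $\mu$ to $\nu$ (that is, $T_\#\mu=\nu$ and $\int c(x,T(x))\,d\mu=\mathcal T_c(\mu,\nu)$) with $T\in C^{r-2}(X)$, and every other optimal map agrees with it $\mu$-almost everywhere. Every Kantorovich potential $u$ is in $C^{r-1}(X)$. Also $g'\circ\bar\mu\in C^{r-1}(X)$, and if $g\in C^r((0,\infty))$ with $g''>0$ on $(0,\infty)$, then $\bar\mu\in C^{r-1}(X)$.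 4. $\nu$ is absolutely continuous with respect to Lebesgue measure. -/

import Mathlib

open Set Filter Topology MeasureTheory
open scoped ENNReal

namespace DoubleMin

noncomputable section

/-- `f ∈ C^k(closure Ω)` for an open set `Ω`: `f` is of class `C^k` in `Ω`, and `f` and all its
derivatives of order at most `k` extend continuously to the closure of `Ω` (the values of `f`
on the boundary being those of its continuous extension). -/
def ContDiffUpToBoundary {E : Type*} [NormedAddCommGroup E] [NormedSpace ℝ E]
    (k : ℕ) (Ω : Set E) (f : E → ℝ) : Prop :=
  ContDiffOn ℝ k f Ω ∧ ContinuousOn f (closure Ω) ∧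
    ∀ j : ℕ, j ≤ k → ∃ G : E → ContinuousMultilinearMap ℝ (fun _ : Fin j => E) ℝ,
      ContinuousOn G (closure Ω) ∧ EqOn (iteratedFDeriv ℝ j f) G Ω

/-- The derivative on the closed interval `[a, b]`; one-sided at the end points. -/
def Dy (a b : ℝ) (f : ℝ → ℝ) (y : ℝ) : ℝ := derivWithin f (Icc a b) y

/-- The second derivative on the closed interval `[a, b]`. -/
def Dyy (a b : ℝ) (f : ℝ → ℝ) (y : ℝ) : ℝ := Dy a b (Dy a b f) y

section Transport

variable {E : Type*} [MeasurableSpace E]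

/-- The couplings `Π(μ, ν)`. -/
def couplings (μ : Measure E) (ν : Measure ℝ) : Set (Measure (E × ℝ)) :=
  {γ | γ.map Prod.fst = μ ∧ γ.map Prod.snd = ν}

/-- The optimal transport cost `𝒯_c(μ, ν)`. -/
def transportCost (c : E → ℝ → ℝ) (μ : Measure E) (ν : Measure ℝ) : ℝ :=
  sInf ((fun γ : Measure (E × ℝ) => ∫ p, c p.1 p.2 ∂γ) '' couplings μ ν)

/-- `T` is an optimal (Monge) map from `μ` to `ν`: it pushes `μ` to `ν`, and the transport plan
`(id, T)_# μ` attains `𝒯_c(μ, ν)`. -/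
def IsOptimalMap (c : E → ℝ → ℝ) (μ : Measure E) (ν : Measure ℝ) (T : E → ℝ) : Prop :=
  AEMeasurable T μ ∧ μ.map T = ν ∧ ∫ x, c x (T x) ∂μ = transportCost c μ ν

end Transport

section Energy

variable {E : Type*} [MeasureSpace E]

/-- The congestion functional `𝒢(μ) = ∫_X g(dμ/dx) dx`, equal to `+∞` if `μ` is not absolutely
continuous with respect to Lebesgue measure on `X`, or if the integral diverges (for `g` bounded
below and `X` of finite measure, it can only diverge to `+∞`). -/
def congestion (g : ℝ → ℝ) (X : Set E) (μ : Measure E) : EReal :=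
  open Classical in
  if μ ≪ volume.restrict X ∧
      IntegrableOn (fun x => g ((μ.rnDeriv (volume.restrict X) x).toReal)) X then
    ((∫ x in X, g ((μ.rnDeriv (volume.restrict X) x).toReal) : ℝ) : EReal)
  else ⊤

/-- The potential and interaction energy `∫ V dν + ½ ∫∫ W dν dν`; its first variation is
`F_{V,W}[ν](y) = V(y) + ∫ W(y, z) dν(z)` when `W` is symmetric. -/
def interactionEnergy (V : ℝ → ℝ) (W : ℝ → ℝ → ℝ) (ν : Measure ℝ) : ℝ :=
  (∫ y, V y ∂ν) + 1 / 2 * (∫ y, (∫ z, W y z ∂ν) ∂ν)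

/-- The total energy `𝒯_c(μ, ν) + 𝒢(μ) + ∫ V dν + ½ ∫∫ W dν dν`. -/
def energy (c : E → ℝ → ℝ) (g : ℝ → ℝ) (V : ℝ → ℝ) (W : ℝ → ℝ → ℝ) (X : Set E)
    (μ : Measure E) (ν : Measure ℝ) : EReal :=
  (transportCost c μ ν : EReal) + congestion g X μ + (interactionEnergy V W ν : EReal)

end Energy

/-- `μ ∈ 𝒫(K)`: `μ` is a probability measure that gives no mass to the complement of `K`. -/
def IsProbOn {E : Type*} [MeasurableSpace E] (K : Set E) (μ : Measure E) : Prop :=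
  IsProbabilityMeasure μ ∧ μ Kᶜ = 0

section Main

variable {m : ℕ}

/-- `(μ, ν)` minimizes the energy over `𝒫(closure X) × 𝒫([a, b])`. -/
def IsDoubleMinimizer (c : EuclideanSpace ℝ (Fin m) → ℝ → ℝ) (g : ℝ → ℝ) (V : ℝ → ℝ)
    (W : ℝ → ℝ → ℝ) (X : Set (EuclideanSpace ℝ (Fin m))) (a b : ℝ)
    (μ : Measure (EuclideanSpace ℝ (Fin m))) (ν : Measure ℝ) : Prop :=
  IsProbOn (closure X) μ ∧ IsProbOn (Icc a b) ν ∧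
    ∀ (μ' : Measure (EuclideanSpace ℝ (Fin m))) (ν' : Measure ℝ),
      IsProbOn (closure X) μ' → IsProbOn (Icc a b) ν' →
        energy c g V W X μ ν ≤ energy c g V W X μ' ν'

/-- Admissible pairs of the dual transport problem. -/
def DualAdmissible (c : EuclideanSpace ℝ (Fin m) → ℝ → ℝ)
    (X : Set (EuclideanSpace ℝ (Fin m))) (a b : ℝ)
    (μ : Measure (EuclideanSpace ℝ (Fin m))) (ν : Measure ℝ)
    (u : EuclideanSpace ℝ (Fin m) → ℝ) (v : ℝ → ℝ) : Prop :=
  Integrable u μ ∧ Integrable v ν ∧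
    ∀ x ∈ closure X, ∀ y ∈ Icc a b, u x + v y ≤ c x y

/-- `(u, v)` is a pair of Kantorovich potentials: a maximizer of the dual problem with
`u = v^c` and `v = u^c`. -/
def IsKantorovichPair (c : EuclideanSpace ℝ (Fin m) → ℝ → ℝ)
    (X : Set (EuclideanSpace ℝ (Fin m))) (a b : ℝ)
    (μ : Measure (EuclideanSpace ℝ (Fin m))) (ν : Measure ℝ)
    (u : EuclideanSpace ℝ (Fin m) → ℝ) (v : ℝ → ℝ) : Prop :=
  DualAdmissible c X a b μ ν u v ∧
  (∀ (u' : EuclideanSpace ℝ (Fin m) → ℝ) (v' : ℝ → ℝ), DualAdmissible c X a b μ ν u' v' →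
    (∫ x, u' x ∂μ) + (∫ y, v' y ∂ν) ≤ (∫ x, u x ∂μ) + (∫ y, v y ∂ν)) ∧
  (∀ x ∈ closure X, IsLeast ((fun y => c x y - v y) '' Icc a b) (u x)) ∧
  (∀ y ∈ Icc a b, IsLeast ((fun x => c x y - u x) '' closure X) (v y))

/-- The level set `X_=(y, k)`. -/
def levelSet (c : EuclideanSpace ℝ (Fin m) → ℝ → ℝ) (X : Set (EuclideanSpace ℝ (Fin m)))
    (a b y k : ℝ) : Set (EuclideanSpace ℝ (Fin m)) :=
  {x | x ∈ X ∧ Dy a b (c x) y = k}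

/-- The super-level set `X_≥(y, k)`. -/
def superLevelSet (c : EuclideanSpace ℝ (Fin m) → ℝ → ℝ) (X : Set (EuclideanSpace ℝ (Fin m)))
    (a b y k : ℝ) : Set (EuclideanSpace ℝ (Fin m)) :=
  {x | x ∈ X ∧ k ≤ Dy a b (c x) y}

/-- The strict super-level set `X_>(y, k)`. -/
def strictSuperLevelSet (c : EuclideanSpace ℝ (Fin m) → ℝ → ℝ)
    (X : Set (EuclideanSpace ℝ (Fin m))) (a b y k : ℝ) : Set (EuclideanSpace ℝ (Fin m)) :=
  superLevelSet c X a b y k \ levelSet c X a b y k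

/-- The value `k` splits the mass proportionately with `y`: `μ(X_≥(y, k)) = ν((-∞, y])`. -/
def IsSplittingLevel (c : EuclideanSpace ℝ (Fin m) → ℝ → ℝ)
    (X : Set (EuclideanSpace ℝ (Fin m))) (a b : ℝ)
    (μ : Measure (EuclideanSpace ℝ (Fin m))) (ν : Measure ℝ) (y k : ℝ) : Prop :=
  μ (superLevelSet c X a b y k) = ν (Iic y)

/-- `(c, μ, ν)` is nested: mass splitting levels `k(y)` exist, and
`X_≥(y₀, k(y₀)) ⊆ X_>(y₁, k(y₁))` whenever `y₀ < y₁` and `ν([y₀, y₁]) > 0`. A mass splitting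
level need not be unique when `ν((-∞, y]) ∈ {0, 1}`; the inclusion is asked for all choices. -/
def IsNested (c : EuclideanSpace ℝ (Fin m) → ℝ → ℝ)
    (X : Set (EuclideanSpace ℝ (Fin m))) (a b : ℝ)
    (μ : Measure (EuclideanSpace ℝ (Fin m))) (ν : Measure ℝ) : Prop :=
  (∀ y ∈ Ioo a b, ∃ k, IsSplittingLevel c X a b μ ν y k) ∧
  ∀ y₀ ∈ Ioo a b, ∀ y₁ ∈ Ioo a b, y₀ < y₁ → 0 < ν (Icc y₀ y₁) →
    ∀ k₀ k₁, IsSplittingLevel c X a b μ ν y₀ k₀ → IsSplittingLevel c X a b μ ν y₁ k₁ →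
      superLevelSet c X a b y₀ k₀ ⊆ strictSuperLevelSet c X a b y₁ k₁

/-- The generalized nestedness condition, for the Kantorovich pair `(u, v)`: for `ν`-almost every
`y`, `v` is differentiable at `y` and `∂^c v(y) = X_=(y, Dv(y))`. -/
def IsGenNested (c : EuclideanSpace ℝ (Fin m) → ℝ → ℝ)
    (X : Set (EuclideanSpace ℝ (Fin m))) (a b : ℝ) (ν : Measure ℝ)
    (u : EuclideanSpace ℝ (Fin m) → ℝ) (v : ℝ → ℝ) : Prop :=
  ∀ᵐ y ∂ν, DifferentiableWithinAt ℝ v (Icc a b) y ∧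
    {x | x ∈ X ∧ u x + v y = c x y} = levelSet c X a b y (Dy a b v y)

end Main

end

end DoubleMin

/-! Freeze the minimizing `ν` and let `F = V + ∫ W(·, z) dν(z)`, the first variation of the
interaction energy. Averaging the hypotheses in `z` shows that every `c(x, ·) + F` is uniformly
convex on `[a, b]` with outward slopes at the ends. Non-degeneracy then makes those slopes strict,
so the minimum point `T x` is interior and is the only zero of `∂_y c(x, ·) + F'`. The implicit
function theorem gives the regularity of `T` and of the minimum value `U(x) = c(x, T x) + F(T x)`,
and non-degeneracy gives `DT ≠ 0`.

The transport cost and the congestion are convex along mixtures of pairs, so only the interaction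
has to be linearized: `(μ, ν)` minimizes `𝒯_c + 𝒢 + ∫ F dν'`
(`IsDoubleMinimizer.exists_density_linearized`). For fixed `μ'`, the best `ν'` is `T_# μ'`, which
leaves `𝒢(μ') + ∫ U dμ'`. The Euler-Lagrange equation `g'(ρ) + U = l` has an explicit positive
solution of mass one, and strict convexity of `g` identifies it with the density of `μ`
(`IsDoubleMinimizer.exists_density_eq`). Equality in this comparison also says that `(U, -F)`
attains the dual value. By quadratic growth, almost optimal plans then concentrate near the graph of
`T`, so `T_# μ = ν` (`map_eq_of_transportCost_add_le`).

The rest is read off from `T`. Since `{T ≤ y} = X_≥(y, -F'(y))`, nestedness is monotonicity of the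
sublevel sets of `T`, once splitting levels are known to cut `X` in the same way
(`level_iff_of_measure_eq`). Any Kantorovich pair is tight along the whole graph of `T`, which
forces `u = U + d` on `X` and `v = -F - d` on the open set `T(X)` (`eq_of_isKantorovichPair`,
`exists_eq_add_const`). Finally, `ν` is absolutely continuous because preimages of null sets under a
map without critical points are null. -/

namespace DoubleMin

/-! ### Derivatives up to the boundary -/

/-- On a convex domain, the iterated directional derivatives of a function of class `C^n` up to the
boundary extend to the closure, and they are still derivatives of each other there. -/
theorem ContDiffUpToBoundary.exists_iterated_directional {E : Type*} [NormedAddCommGroup E]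
    [NormedSpace ℝ E] {n : ℕ} {Ω : Set E} {f : E → ℝ} (hf : ContDiffUpToBoundary n Ω f)
    (hΩ : IsOpen Ω) (hconv : Convex ℝ Ω) (e : E) :
    ∃ P : ℕ → E → ℝ, EqOn (P 0) f (closure Ω) ∧
      (∀ j ≤ n, ContinuousOn (P j) (closure Ω)) ∧
      ∀ j < n, ∀ p ∈ closure Ω, ∃ L : E →L[ℝ] ℝ,
        HasFDerivWithinAt (P j) L (closure Ω) p ∧ L e = P (j + 1) p := by
  obtain ⟨h1, h2, h3⟩ := hf
  choose! G hGc hGe using h3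
  have hcont : ∀ j ≤ n, ContinuousOn (fun p => G j p fun _ => e) (closure Ω) := fun j hj =>
    (ContinuousMultilinearMap.apply ℝ (fun _ : Fin j => E) ℝ (fun _ => e)).continuous.comp_continuousOn
      (hGc j hj)
  have hdiff : ∀ j < n, ∀ q ∈ Ω, HasFDerivAt (fun p => G j p fun _ => e)
      ((ContinuousMultilinearMap.apply ℝ (fun _ : Fin j => E) ℝ (fun _ => e)).comp
        ((G (j + 1) q).curryLeft)) q := by
    intro j hj q hq
    have hd : DifferentiableAt ℝ (iteratedFDeriv ℝ j f) q :=
      (h1.contDiffAt (hΩ.mem_nhds hq)).differentiableAt_iteratedFDeriv (by exact_mod_cast hj)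
    have hd2 : HasFDerivAt (iteratedFDeriv ℝ j f) ((G (j + 1) q).curryLeft) q := by
      have h := hd.hasFDerivAt
      have e2 : fderiv ℝ (iteratedFDeriv ℝ j f) q = (G (j + 1) q).curryLeft := by
        rw [← hGe (j + 1) hj hq]
        ext v w
        simp [iteratedFDeriv_succ_apply_left]
      rwa [e2] at h
    have h := (ContinuousMultilinearMap.apply ℝ (fun _ : Fin j => E) ℝ
      (fun _ => e)).hasFDerivAt.comp q hd2
    refine h.congr_of_eventuallyEq ?_
    filter_upwards [hΩ.mem_nhds hq] with p hp
    simp [← hGe j hj.le hp]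
  refine ⟨fun j p => G j p fun _ => e, ?_, hcont, ?_⟩
  · have : EqOn (fun p => G 0 p fun _ => e) f Ω := fun p hp => by
      simp [← hGe 0 (Nat.zero_le _) hp]
    exact this.of_subset_closure (hcont 0 (Nat.zero_le _)) h2 subset_closure subset_rfl
  · intro j hj p hp
    refine ⟨(ContinuousMultilinearMap.apply ℝ (fun _ : Fin j => E) ℝ (fun _ => e)).comp
        ((G (j + 1) p).curryLeft), ?_, ?_⟩
    -- At a boundary point the derivative is the limit of interior derivatives; the mean value
    -- inequality behind this is where convexity of `Ω` enters.
    · refine hasFDerivWithinAt_closure_of_tendsto_fderiv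
        (fun q hq => (hdiff j hj q hq).differentiableAt.differentiableWithinAt) hconv hΩ
        (fun q hq => (hcont j hj.le q hq).mono subset_closure) ?_
      have hc : ContinuousOn (fun q =>
          (ContinuousMultilinearMap.apply ℝ (fun _ : Fin j => E) ℝ (fun _ => e)).comp
            ((G (j + 1) q).curryLeft)) (closure Ω) := by
        refine continuousOn_const.clm_comp ?_
        exact (continuousMultilinearCurryLeftEquiv ℝ (fun _ : Fin (j + 1) => E)
          ℝ).continuous.comp_continuousOn (hGc (j + 1) hj)
      refine ((hc p hp).mono subset_closure).tendsto.congr' ?_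
      filter_upwards [self_mem_nhdsWithin] with q hq
      exact (hdiff j hj q hq).fderiv.symm
    · simp only [ContinuousLinearMap.comp_apply, ContinuousMultilinearMap.apply_apply]
      rw [ContinuousMultilinearMap.curryLeft_apply]
      congr 1
      ext i
      refine Fin.cases ?_ (fun i => ?_) i <;> simp

theorem Dy_eq {a b : ℝ} (hab : a < b) {f : ℝ → ℝ} {f' y : ℝ}
    (h : HasDerivWithinAt f f' (Icc a b) y) (hy : y ∈ Icc a b) : Dy a b f y = f' :=
  h.derivWithin (uniqueDiffOn_Icc hab y hy)

theorem Dy_congr {a b : ℝ} {f g : ℝ → ℝ} (h : EqOn f g (Icc a b)) : EqOn (Dy a b f) (Dy a b g) (Icc a b) :=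
  fun _ hy => derivWithin_congr h (h hy)

theorem Dyy_congr {a b : ℝ} {f g : ℝ → ℝ} (h : EqOn f g (Icc a b)) :
    EqOn (Dyy a b f) (Dyy a b g) (Icc a b) :=
  Dy_congr (Dy_congr h)

theorem Dyy_eq {a b : ℝ} (hab : a < b) {f f' : ℝ → ℝ} {f'' y : ℝ}
    (h : ∀ y ∈ Icc a b, HasDerivWithinAt f (f' y) (Icc a b) y)
    (h' : HasDerivWithinAt f' f'' (Icc a b) y) (hy : y ∈ Icc a b) : Dyy a b f y = f'' := by
  have : EqOn (Dy a b f) f' (Icc a b) := fun t ht => Dy_eq hab (h t ht) ht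
  exact (Dy_congr this hy).trans (Dy_eq hab h' hy)

/-- Derivatives in the second variable of a function that is `C^n` up to the boundary of a
product domain. -/
theorem ContDiffUpToBoundary.exists_partial {E : Type*} [NormedAddCommGroup E]
    [NormedSpace ℝ E] {n : ℕ} {B : Set E} {a b : ℝ} (hab : a < b) {f : E → ℝ → ℝ}
    (hf : ContDiffUpToBoundary n (B ×ˢ Ioo a b) (Function.uncurry f))
    (hB : IsOpen B) (hconv : Convex ℝ B) :
    ∃ P : ℕ → E → ℝ → ℝ, (∀ x ∈ closure B, EqOn (P 0 x) (f x) (Icc a b)) ∧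
      (∀ j ≤ n, ContinuousOn (Function.uncurry (P j)) (closure B ×ˢ Icc a b)) ∧
      ∀ j < n, ∀ x ∈ closure B, ∀ y ∈ Icc a b,
        HasDerivWithinAt (P j x) (P (j + 1) x y) (Icc a b) y := by
  have hcl : closure (B ×ˢ Ioo a b) = closure B ×ˢ Icc a b := by
    rw [closure_prod_eq, closure_Ioo hab.ne]
  obtain ⟨P, h0, h1, h2⟩ := hf.exists_iterated_directional (hB.prod isOpen_Ioo)
    (hconv.prod (convex_Ioo a b)) ((0 : E), (1 : ℝ))
  rw [hcl] at h0 h1 h2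
  refine ⟨fun j x y => P j (x, y), fun x hx y hy => h0 ⟨hx, hy⟩, fun j hj => h1 j hj, ?_⟩
  intro j hj x hx y hy
  obtain ⟨L, hL, hLe⟩ := h2 j hj (x, y) ⟨hx, hy⟩
  have hline : HasDerivWithinAt (fun t : ℝ => (x, t)) ((0 : E), (1 : ℝ)) (Icc a b) y :=
    (hasDerivWithinAt_const y _ x).prodMk (hasDerivWithinAt_id y _)
  have := hL.comp_hasDerivWithinAt y hline (fun t ht => ⟨hx, ht⟩)
  rwa [hLe] at this

theorem ContDiffUpToBoundary.mono {E : Type*} [NormedAddCommGroup E]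
    [NormedSpace ℝ E] {n : ℕ} {Ω Ω' : Set E} {f : E → ℝ} (hf : ContDiffUpToBoundary n Ω f)
    (h : Ω' ⊆ Ω) : ContDiffUpToBoundary n Ω' f := by
  refine ⟨hf.1.mono h, hf.2.1.mono (closure_mono h), fun j hj => ?_⟩
  obtain ⟨G, h1, h2⟩ := hf.2.2 j hj
  exact ⟨G, h1.mono (closure_mono h), h2.mono h⟩

theorem ContDiffUpToBoundary.exists_derivs {n : ℕ} {a b : ℝ} (hab : a < b) {f : ℝ → ℝ}
    (hf : ContDiffUpToBoundary n (Ioo a b) f) :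
    ∃ P : ℕ → ℝ → ℝ, EqOn (P 0) f (Icc a b) ∧ (∀ j ≤ n, ContinuousOn (P j) (Icc a b)) ∧
      ∀ j < n, ∀ y ∈ Icc a b, HasDerivWithinAt (P j) (P (j + 1) y) (Icc a b) y := by
  obtain ⟨P, h0, h1, h2⟩ := hf.exists_iterated_directional isOpen_Ioo (convex_Ioo a b) (1 : ℝ)
  rw [closure_Ioo hab.ne] at h0 h1 h2
  refine ⟨P, h0, h1, fun j hj y hy => ?_⟩
  obtain ⟨L, hL, hLe⟩ := h2 j hj y hy
  have := hL.hasDerivWithinAt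
  rwa [hLe] at this

/-! ### Differentiation under the integral and the first variation -/

section Param

variable {a b : ℝ} {ν : Measure ℝ} [IsProbabilityMeasure ν]

theorem integrable_of_continuousOn_Icc (hν : ν (Icc a b)ᶜ = 0) {f : ℝ → ℝ}
    (hf : ContinuousOn f (Icc a b)) : Integrable f ν := by
  have : ν.restrict (Icc a b) = ν := Measure.restrict_eq_self_of_ae_mem (mem_ae_iff.2 hν)
  rw [← this]
  exact hf.integrableOn_compact isCompact_Icc

theorem continuousOn_integral_param (hν : ν (Icc a b)ᶜ = 0) {f : ℝ → ℝ → ℝ}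
    (hf : ContinuousOn (Function.uncurry f) (Icc a b ×ˢ Icc a b)) :
    ContinuousOn (fun y => ∫ z, f z y ∂ν) (Icc a b) := by
  have hae : ∀ᵐ z ∂ν, z ∈ Icc a b := mem_ae_iff.2 hν
  obtain ⟨M, hM⟩ := (isCompact_Icc.prod isCompact_Icc).exists_bound_of_continuousOn hf
  intro y hy
  refine continuousWithinAt_of_dominated (bound := fun _ => M) ?_ ?_ (integrable_const M) ?_
  · filter_upwards [self_mem_nhdsWithin] with t ht
    exact (integrable_of_continuousOn_Icc hν
      (hf.comp (f := fun z => (z, t)) (by fun_prop) fun z hz => ⟨hz, ht⟩)).aestronglyMeasurable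
  · filter_upwards [self_mem_nhdsWithin] with t ht
    filter_upwards [hae] with z hz using hM (z, t) ⟨hz, ht⟩
  · filter_upwards [hae] with z hz
    exact (hf.comp (f := fun y => (z, y)) (by fun_prop) fun t ht => ⟨hz, ht⟩) y hy

/-- Dominated convergence for difference quotients: the mean value inequality bounds them by the
supremum of `f'` over the compact square. Slopes are taken within `[a, b]`, so the end points are
included. -/
theorem hasDerivWithinAt_integral_param (hν : ν (Icc a b)ᶜ = 0) {f f' : ℝ → ℝ → ℝ}
    (hf : ContinuousOn (Function.uncurry f) (Icc a b ×ˢ Icc a b))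
    (hf' : ContinuousOn (Function.uncurry f') (Icc a b ×ˢ Icc a b))
    (hd : ∀ z ∈ Icc a b, ∀ y ∈ Icc a b, HasDerivWithinAt (f z) (f' z y) (Icc a b) y)
    {y : ℝ} (hy : y ∈ Icc a b) :
    HasDerivWithinAt (fun y => ∫ z, f z y ∂ν) (∫ z, f' z y ∂ν) (Icc a b) y := by
  have hae : ∀ᵐ z ∂ν, z ∈ Icc a b := mem_ae_iff.2 hν
  obtain ⟨M, hM⟩ := (isCompact_Icc.prod isCompact_Icc).exists_bound_of_continuousOn hf'
  have hint : ∀ t ∈ Icc a b, Integrable (fun z => f z t) ν := fun t ht =>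
    integrable_of_continuousOn_Icc hν
      (hf.comp (f := fun z => (z, t)) (by fun_prop) fun z hz => ⟨hz, ht⟩)
  rw [hasDerivWithinAt_iff_tendsto_slope]
  have key : Tendsto (fun t => ∫ z, slope (f z) y t ∂ν) (𝓝[Icc a b \ {y}] y)
      (𝓝 (∫ z, f' z y ∂ν)) := by
    refine tendsto_integral_filter_of_dominated_convergence (fun _ => M) ?_ ?_
      (integrable_const M) ?_
    · filter_upwards [self_mem_nhdsWithin] with t ht
      simp only [slope_def_field]
      exact (((hint t ht.1).sub (hint y hy)).div_const _).aestronglyMeasurable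
    · filter_upwards [self_mem_nhdsWithin] with t ht
      filter_upwards [hae] with z hz
      have := (convex_Icc a b).norm_image_sub_le_of_norm_hasDerivWithin_le (f := f z)
        (f' := f' z) (C := M) (fun x hx => hd z hz x hx) (fun x hx => hM (z, x) ⟨hz, hx⟩) hy ht.1
      rw [slope_def_field, norm_div]
      exact div_le_of_le_mul₀ (norm_nonneg _) ((norm_nonneg _).trans (hM (y, y) ⟨hy, hy⟩)) this
    · filter_upwards [hae] with z hz
      exact hasDerivWithinAt_iff_tendsto_slope.1 (hd z hz y hy)
  refine key.congr' ?_
  filter_upwards [self_mem_nhdsWithin] with t ht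
  simp only [slope_def_field]
  rw [integral_div, integral_sub (hint t ht.1) (hint y hy)]

/-- The hypotheses on `W` are given for interior `z` only, whereas `ν` may a priori charge `a` or
`b`; continuity carries the bound to the end points. -/
theorem le_integral_of_forall_Ioo (hab : a < b) (hν : ν (Icc a b)ᶜ = 0) {f : ℝ → ℝ}
    (hf : ContinuousOn f (Icc a b)) {α : ℝ} (h : ∀ z ∈ Ioo a b, α ≤ f z) : α ≤ ∫ z, f z ∂ν := by
  have h2 : ∀ z ∈ Icc a b, α ≤ f z := by
    have hcl := closure_Ioo hab.ne
    intro z hz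
    refine ContinuousWithinAt.closure_le (s := Ioo a b) (f := fun _ => α) (g := f)
      (by rwa [hcl]) continuousWithinAt_const ((hf z hz).mono Ioo_subset_Icc_self) h
  calc α = ∫ _, α ∂ν := by simp
    _ ≤ _ := integral_mono_ae (integrable_const _) (integrable_of_continuousOn_Icc hν hf) (by
        filter_upwards [mem_ae_iff.2 hν] with z hz using h2 z hz)

end Param

theorem contDiffOn_of_hasDerivAt_chain {s : Set ℝ} (hs : IsOpen s) :
    ∀ (n : ℕ) (D : ℕ → ℝ → ℝ), (∀ j < n, ∀ y ∈ s, HasDerivAt (D j) (D (j + 1) y) y) →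
      ContinuousOn (D n) s → ContDiffOn ℝ n (D 0) s
  | 0, D, _, hc => by simpa using hc
  | n + 1, D, hd, hc => by
    have ih := contDiffOn_of_hasDerivAt_chain hs n (fun j => D (j + 1))
      (fun j hj y hy => hd (j + 1) (by omega) y hy) hc
    rw [show ((n + 1 : ℕ) : WithTop ℕ∞) = (n : WithTop ℕ∞) + 1 by push_cast; rfl,
      contDiffOn_succ_iff_deriv_of_isOpen hs]
    refine ⟨fun y hy => (hd 0 (by omega) y hy).differentiableAt.differentiableWithinAt, by simp, ?_⟩
    exact ih.congr fun y hy => (hd 0 (by omega) y hy).deriv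

/-- The first variation `y ↦ V y + ∫ W(y, z) dν(z)` of the interaction energy is of class `C^n` up
to the end points, and bounds on the integrand's derivatives pass to it. -/
theorem exists_derivs_firstVariation {n : ℕ} (hn : 2 ≤ n) {a b : ℝ} (hab : a < b) {V : ℝ → ℝ}
    {W : ℝ → ℝ → ℝ} (hV : ContDiffUpToBoundary n (Ioo a b) V)
    (hW : ContDiffUpToBoundary n (Ioo a b ×ˢ Ioo a b) (Function.uncurry W))
    (hWsymm : ∀ y ∈ Icc a b, ∀ z ∈ Icc a b, W y z = W z y)
    {ν : Measure ℝ} [IsProbabilityMeasure ν] (hν : ν (Icc a b)ᶜ = 0) :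
    ∃ D : ℕ → ℝ → ℝ, EqOn (D 0) (fun y => V y + ∫ z, W y z ∂ν) (Icc a b) ∧
      (∀ j ≤ n, ContinuousOn (D j) (Icc a b)) ∧
      (∀ j < n, ∀ y ∈ Icc a b, HasDerivWithinAt (D j) (D (j + 1) y) (Icc a b) y) ∧
      (∀ y ∈ Icc a b, ∀ α, (∀ z ∈ Ioo a b, α ≤ Dy a b V y + Dy a b (fun y' => W y' z) y) →
        α ≤ D 1 y) ∧
      (∀ y ∈ Icc a b, ∀ α, (∀ z ∈ Ioo a b, Dy a b V y + Dy a b (fun y' => W y' z) y ≤ α) →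
        D 1 y ≤ α) ∧
      (∀ y ∈ Icc a b, ∀ α, (∀ z ∈ Ioo a b, α ≤ Dyy a b V y + Dyy a b (fun y' => W y' z) y) →
        α ≤ D 2 y) := by
  obtain ⟨P, hP0, hPc, hPd⟩ := hV.exists_derivs hab
  obtain ⟨Q, hQ0, hQc, hQd⟩ := hW.exists_partial hab isOpen_Ioo (convex_Ioo a b)
  rw [closure_Ioo hab.ne] at hQ0 hQc hQd
  have hQy : ∀ j ≤ n, ∀ y ∈ Icc a b, ContinuousOn (fun z => Q j z y) (Icc a b) :=
    fun j hj y hy => (hQc j hj).comp (f := fun z => (z, y)) (by fun_prop) fun z hz => ⟨hz, hy⟩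
  -- `Q` differentiates `W` in its second slot; symmetry turns this into the derivative of `W(·,
  -- z)`.
  have hWQ : ∀ z ∈ Icc a b, EqOn (fun y => W y z) (Q 0 z) (Icc a b) := fun z hz y hy =>
    (hWsymm y hy z hz).trans (hQ0 z hz hy).symm
  have hV1 : ∀ y ∈ Icc a b, Dy a b V y = P 1 y := fun y hy =>
    (Dy_congr hP0.symm hy).trans (Dy_eq hab (hPd 0 (by omega) y hy) hy)
  have hV2 : ∀ y ∈ Icc a b, Dyy a b V y = P 2 y := fun y hy =>
    (Dyy_congr hP0.symm hy).trans (Dyy_eq hab (hPd 0 (by omega)) (hPd 1 (by omega) y hy) hy)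
  have hW1 : ∀ z ∈ Icc a b, ∀ y ∈ Icc a b, Dy a b (fun y' => W y' z) y = Q 1 z y :=
    fun z hz y hy => (Dy_congr (hWQ z hz) hy).trans (Dy_eq hab (hQd 0 (by omega) z hz y hy) hy)
  have hW2 : ∀ z ∈ Icc a b, ∀ y ∈ Icc a b, Dyy a b (fun y' => W y' z) y = Q 2 z y :=
    fun z hz y hy => (Dyy_congr (hWQ z hz) hy).trans
      (Dyy_eq hab (hQd 0 (by omega) z hz) (hQd 1 (by omega) z hz y hy) hy)
  have hae : ∀ᵐ z ∂ν, z ∈ Icc a b := mem_ae_iff.2 hν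
  refine ⟨fun j y => P j y + ∫ z, Q j z y ∂ν, ?_, ?_, ?_, ?_, ?_, ?_⟩
  · intro y hy
    simp only [hP0 hy]
    congr 1
    refine integral_congr_ae ?_
    filter_upwards [hae] with z hz using (hWQ z hz hy).symm
  · exact fun j hj => (hPc j hj).add (continuousOn_integral_param hν (hQc j hj))
  · exact fun j hj y hy => (hPd j hj y hy).add
      (hasDerivWithinAt_integral_param hν (hQc j hj.le) (hQc (j + 1) hj) (hQd j hj) hy)
  · intro y hy α h
    have := le_integral_of_forall_Ioo hab hν (hQy 1 (by omega) y hy) (α := α - P 1 y)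
      fun z hz => by
        have := h z hz
        rw [hV1 y hy, hW1 z (Ioo_subset_Icc_self hz) y hy] at this
        linarith
    linarith
  · intro y hy α h
    have := le_integral_of_forall_Ioo hab hν (hQy 1 (by omega) y hy).neg (α := P 1 y - α)
      fun z hz => by
        have := h z hz
        rw [hV1 y hy, hW1 z (Ioo_subset_Icc_self hz) y hy] at this
        simp only [Pi.neg_apply]
        linarith
    simp only [Pi.neg_apply] at this
    rw [integral_neg] at this
    linarith
  · intro y hy α h
    have := le_integral_of_forall_Ioo hab hν (hQy 2 hn y hy) (α := α - P 2 y)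
      fun z hz => by
        have := h z hz
        rw [hV2 y hy, hW2 z (Ioo_subset_Icc_self hz) y hy] at this
        linarith
    linarith

/-! ### Convexity of the cost plus a potential -/

section Cost

variable {E : Type*} [NormedAddCommGroup E] [NormedSpace ℝ E] {n : ℕ} {X : Set E} {a b : ℝ}
  {c : E → ℝ → ℝ}

theorem exists_cost_derivs (hn : 2 ≤ n) (hX : IsOpen X) (hab : a < b)
    (hc : ContDiffUpToBoundary n (X ×ˢ Ioo a b) (Function.uncurry c)) {x : E} (hx : x ∈ X) :
    (∀ y ∈ Icc a b, HasDerivWithinAt (c x) (Dy a b (c x) y) (Icc a b) y) ∧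
    (∀ y ∈ Icc a b, HasDerivWithinAt (Dy a b (c x)) (Dyy a b (c x) y) (Icc a b) y) := by
  -- `X` itself need not be convex, so the extension results are applied on a small ball around `x`.
  obtain ⟨r, hr, hrX⟩ := Metric.isOpen_iff.1 hX x hx
  obtain ⟨P, h0, -, h2⟩ := (hc.mono (prod_mono hrX subset_rfl)).exists_partial hab
    Metric.isOpen_ball (convex_ball x r)
  have hx' : x ∈ closure (Metric.ball x r) := subset_closure (Metric.mem_ball_self hr)
  have hd0 : ∀ y ∈ Icc a b, HasDerivWithinAt (c x) (P 1 x y) (Icc a b) y := fun y hy =>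
    (h2 0 (by omega) x hx' y hy).congr (fun t ht => (h0 x hx' ht).symm) (h0 x hx' hy).symm
  have e1 : EqOn (Dy a b (c x)) (P 1 x) (Icc a b) := fun y hy => Dy_eq hab (hd0 y hy) hy
  have hd1 : ∀ y ∈ Icc a b, HasDerivWithinAt (Dy a b (c x)) (P 2 x y) (Icc a b) y := fun y hy =>
    (h2 1 (by omega) x hx' y hy).congr (fun t ht => e1 ht) (e1 hy)
  refine ⟨fun y hy => by rw [e1 hy]; exact hd0 y hy, fun y hy => ?_⟩
  rw [show Dyy a b (c x) y = P 2 x y from Dy_eq hab (hd1 y hy) hy]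
  exact hd1 y hy

theorem contDiffOn_Dy_cost (hX : IsOpen X)
    (hc : ContDiffUpToBoundary (n + 1) (X ×ˢ Ioo a b) (Function.uncurry c)) :
    ContDiffOn ℝ n (fun p : E × ℝ => Dy a b (c p.1) p.2) (X ×ˢ Ioo a b) := by
  have hopen := hX.prod (isOpen_Ioo (a := a) (b := b))
  have h : ContDiffOn ℝ n (fun p => fderiv ℝ (Function.uncurry c) p ((0 : E), (1 : ℝ)))
      (X ×ˢ Ioo a b) :=
    (hc.1.fderiv_of_isOpen hopen (by exact_mod_cast le_rfl)).clm_apply contDiffOn_const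
  refine h.congr fun p hp => ?_
  have hd : HasFDerivAt (Function.uncurry c) (fderiv ℝ (Function.uncurry c) p) p :=
    ((hc.1.contDiffAt (hopen.mem_nhds hp)).differentiableAt (by simp)).hasFDerivAt
  have hline : HasDerivAt (fun t : ℝ => (p.1, t)) ((0 : E), (1 : ℝ)) p.2 :=
    (hasDerivAt_const p.2 p.1).prodMk (hasDerivAt_id p.2)
  have h1 : HasDerivAt (c p.1) (fderiv ℝ (Function.uncurry c) p ((0 : E), (1 : ℝ))) p.2 :=
    HasFDerivAt.comp_hasDerivAt (l := Function.uncurry c) (f := fun t : ℝ => (p.1, t)) p.2 hd hline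
  exact (h1.hasDerivWithinAt).derivWithin (uniqueDiffOn_Icc (hp.2.1.trans hp.2.2) _
    (Ioo_subset_Icc_self hp.2))

end Cost

/-- `F` is a potential on `[a, b]` for which `c(x, ·) + F` is uniformly convex, with gradient
pointing outward at the end points, for every `x ∈ X`. -/
structure IsConvexifying {E : Type*} (n : ℕ) (X : Set E) (a b : ℝ) (c : E → ℝ → ℝ)
    (F F' : ℝ → ℝ) (C : ℝ) : Prop where
  hasDeriv : ∀ y ∈ Icc a b, HasDerivWithinAt F (F' y) (Icc a b) y
  hasDeriv_two : ∀ y ∈ Icc a b, HasDerivWithinAt F' (Dyy a b F y) (Icc a b) y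
  contDiffOn : ContDiffOn ℝ n F' (Ioo a b)
  contDiffOn_self : ContDiffOn ℝ (n + 1 : ℕ) F (Ioo a b)
  pos : 0 < C
  convex : ∀ x ∈ X, ∀ y ∈ Ioo a b, C ≤ Dyy a b (c x) y + Dyy a b F y
  right : ∀ x ∈ X, 0 ≤ Dy a b (c x) b + F' b
  left : ∀ x ∈ X, Dy a b (c x) a + F' a ≤ 0

/-- Convexity and the outward slope conditions are affine in the `W` term, so they survive averaging
in `z` against the probability measure `ν`. No constant is lost: the same `C` works. -/
theorem exists_isConvexifying_firstVariation {E : Type*} {n : ℕ} (hn : 1 ≤ n) {a b : ℝ}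
    (hab : a < b) {X : Set E} {c : E → ℝ → ℝ} {V : ℝ → ℝ}
    {W : ℝ → ℝ → ℝ} (hV : ContDiffUpToBoundary (n + 1) (Ioo a b) V)
    (hW : ContDiffUpToBoundary (n + 1) (Ioo a b ×ˢ Ioo a b) (Function.uncurry W))
    (hWsymm : ∀ y ∈ Icc a b, ∀ z ∈ Icc a b, W y z = W z y)
    {C : ℝ} (hC : 0 < C) (hconv : ∀ x ∈ X, ∀ y ∈ Ioo a b, ∀ z ∈ Ioo a b,
      C ≤ Dyy a b (c x) y + Dyy a b V y + Dyy a b (fun y' => W y' z) y)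
    (hright : ∀ x ∈ X, ∀ z ∈ Ioo a b,
      0 ≤ Dy a b (c x) b + Dy a b V b + Dy a b (fun y' => W y' z) b)
    (hleft : ∀ x ∈ X, ∀ z ∈ Ioo a b,
      Dy a b (c x) a + Dy a b V a + Dy a b (fun y' => W y' z) a ≤ 0)
    {ν : Measure ℝ} [IsProbabilityMeasure ν] (hν : ν (Icc a b)ᶜ = 0) :
    ∃ F', IsConvexifying n X a b c (fun y => V y + ∫ z, W y z ∂ν) F' C := by
  obtain ⟨D, h0, hcont, hd, h1, h1', h2⟩ :=
    exists_derivs_firstVariation (by omega) hab hV hW hWsymm hν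
  have hd0 : ∀ y ∈ Icc a b, HasDerivWithinAt (fun y => V y + ∫ z, W y z ∂ν) (D 1 y) (Icc a b) y :=
    fun y hy => (hd 0 (by omega) y hy).congr (fun t ht => (h0 ht).symm) (h0 hy).symm
  have e2 : ∀ y ∈ Icc a b, Dyy a b (fun y => V y + ∫ z, W y z ∂ν) y = D 2 y := fun y hy =>
    Dyy_eq hab hd0 (hd 1 (by omega) y hy) hy
  have hda : ∀ j < n + 1, ∀ y ∈ Ioo a b, HasDerivAt (D j) (D (j + 1) y) y := fun j hj y hy =>
    (hd j hj y (Ioo_subset_Icc_self hy)).hasDerivAt (Icc_mem_nhds hy.1 hy.2)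
  refine ⟨D 1, hd0, fun y hy => ?_, ?_, ?_, hC, fun x hx y hy => ?_, fun x hx => ?_,
    fun x hx => ?_⟩
  · rw [e2 y hy]
    exact hd 1 (by omega) y hy
  · exact contDiffOn_of_hasDerivAt_chain isOpen_Ioo n (fun j => D (j + 1))
      (fun j hj => hda (j + 1) (by omega)) ((hcont (n + 1) le_rfl).mono Ioo_subset_Icc_self)
  · refine (contDiffOn_of_hasDerivAt_chain isOpen_Ioo (n + 1) D hda
      ((hcont _ le_rfl).mono Ioo_subset_Icc_self)).congr fun y hy =>
        (h0 (Ioo_subset_Icc_self hy)).symm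
  · have hy' := Ioo_subset_Icc_self hy
    rw [e2 y hy']
    have := h2 y hy' (C - Dyy a b (c x) y) fun z hz => by linarith [hconv x hx y hy z hz]
    linarith
  · have := h1 b (right_mem_Icc.2 hab.le) (-Dy a b (c x) b) fun z hz => by
      linarith [hright x hx z hz]
    linarith
  · have := h1' a (left_mem_Icc.2 hab.le) (-Dy a b (c x) a) fun z hz => by
      linarith [hleft x hx z hz]
    linarith

namespace IsConvexifying

variable {E : Type*} [NormedAddCommGroup E] [NormedSpace ℝ E] {n : ℕ} {X : Set E} {a b : ℝ}
  {c : E → ℝ → ℝ} {F F' : ℝ → ℝ} {C : ℝ}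

theorem slope_mono (h : IsConvexifying n X a b c F F' C) (hX : IsOpen X) (hab : a < b)
    (hn : 1 ≤ n) (hc : ContDiffUpToBoundary (n + 1) (X ×ˢ Ioo a b) (Function.uncurry c))
    {x : E} (hx : x ∈ X) {y y' : ℝ} (hy : y ∈ Icc a b) (hy' : y' ∈ Icc a b) (hyy : y ≤ y') :
    C * (y' - y) ≤ (Dy a b (c x) y' + F' y') - (Dy a b (c x) y + F' y) := by
  obtain ⟨-, hd⟩ := exists_cost_derivs (by omega) hX hab hc hx
  have hder : ∀ y ∈ Icc a b, HasDerivWithinAt (fun y => Dy a b (c x) y + F' y)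
      (Dyy a b (c x) y + Dyy a b F y) (Icc a b) y := fun y hy =>
    (hd y hy).add (h.hasDeriv_two y hy)
  have hda : ∀ y ∈ Ioo a b, HasDerivAt (fun y => Dy a b (c x) y + F' y)
      (Dyy a b (c x) y + Dyy a b F y) y := fun y hy =>
    (hder y (Ioo_subset_Icc_self hy)).hasDerivAt (Icc_mem_nhds hy.1 hy.2)
  refine (convex_Icc a b).mul_sub_le_image_sub_of_le_deriv
    (fun y hy => (hder y hy).continuousWithinAt) ?_ ?_ y hy y' hy' hyy
  · rw [interior_Icc]
    exact fun y hy => (hda y hy).differentiableAt.differentiableWithinAt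
  · rw [interior_Icc]
    intro y hy
    rw [(hda y hy).deriv]
    exact h.convex x hx y hy

theorem continuousOn_slope (h : IsConvexifying n X a b c F F' C) (hX : IsOpen X) (hab : a < b)
    (hn : 1 ≤ n) (hc : ContDiffUpToBoundary (n + 1) (X ×ˢ Ioo a b) (Function.uncurry c))
    {x : E} (hx : x ∈ X) : ContinuousOn (fun y => Dy a b (c x) y + F' y) (Icc a b) := by
  obtain ⟨-, hd⟩ := exists_cost_derivs (by omega) hX hab hc hx
  exact fun y hy => ((hd y hy).add (h.hasDeriv_two y hy)).continuousWithinAt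

/-- If the slope vanished at `b` for some `x ∈ X`, then `x` would minimize the nonnegative function
`x' ↦ ∂_y c(x', b) + F'(b)` on an open set, contradicting non-degeneracy; similarly at `a`. Hence
the slope changes sign strictly and has an interior zero. -/
theorem exists_argmin (h : IsConvexifying n X a b c F F' C) (hX : IsOpen X) (hab : a < b)
    (hn : 1 ≤ n) (hc : ContDiffUpToBoundary (n + 1) (X ×ˢ Ioo a b) (Function.uncurry c))
    (hnondeg : ∀ x ∈ X, ∀ y ∈ Icc a b, fderiv ℝ (fun x' => Dy a b (c x') y) x ≠ 0) :
    ∃ T : E → ℝ, ∀ x ∈ X, T x ∈ Ioo a b ∧ Dy a b (c x) (T x) + F' (T x) = 0 := by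
  have key : ∀ x ∈ X, ∃ t, t ∈ Ioo a b ∧ Dy a b (c x) t + F' t = 0 := by
    intro x hx
    have hl : Dy a b (c x) a + F' a < 0 := by
      refine lt_of_le_of_ne (h.left x hx) fun h0 => hnondeg x hx a (left_mem_Icc.2 hab.le) ?_
      refine IsLocalMax.fderiv_eq_zero ?_
      filter_upwards [hX.mem_nhds hx] with x' hx'
      linarith [h.left x' hx']
    have hr : 0 < Dy a b (c x) b + F' b := by
      refine lt_of_le_of_ne (h.right x hx) fun h0 => hnondeg x hx b (right_mem_Icc.2 hab.le) ?_
      refine IsLocalMin.fderiv_eq_zero ?_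
      filter_upwards [hX.mem_nhds hx] with x' hx'
      linarith [h.right x' hx']
    obtain ⟨t, ht, ht0⟩ := intermediate_value_Ioo hab.le (h.continuousOn_slope hX hab hn hc hx)
      ⟨hl, hr⟩
    exact ⟨t, ht, ht0⟩
  choose! T hT using key
  exact ⟨T, hT⟩

end IsConvexifying

/-! ### The minimum map and its regularity -/

/-- `T x` is the critical point (hence the minimum point) of `c(x, ·) + F` for every `x ∈ X`. -/
structure IsArgminMap {E : Type*} [NormedAddCommGroup E] [NormedSpace ℝ E] (n : ℕ) (X : Set E)
    (a b : ℝ) (c : E → ℝ → ℝ) (F F' : ℝ → ℝ) (C : ℝ) (T : E → ℝ) : Prop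
    extends IsConvexifying n X a b c F F' C where
  isOpen : IsOpen X
  lt : a < b
  one_le : 1 ≤ n
  contDiff : ContDiffUpToBoundary (n + 1) (X ×ˢ Ioo a b) (Function.uncurry c)
  nondeg : ∀ x ∈ X, ∀ y ∈ Icc a b, fderiv ℝ (fun x' => Dy a b (c x') y) x ≠ 0
  mem : ∀ x ∈ X, T x ∈ Ioo a b
  slope_eq_zero : ∀ x ∈ X, Dy a b (c x) (T x) + F' (T x) = 0

namespace IsArgminMap

variable {E : Type*} [NormedAddCommGroup E] [NormedSpace ℝ E] {n : ℕ} {X : Set E} {a b : ℝ}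
  {c : E → ℝ → ℝ} {F F' : ℝ → ℝ} {C : ℝ} {T : E → ℝ}

theorem mem_Icc (h : IsArgminMap n X a b c F F' C T) {x : E} (hx : x ∈ X) : T x ∈ Icc a b :=
  Ioo_subset_Icc_self (h.mem x hx)

theorem slope_mono (h : IsArgminMap n X a b c F F' C T) {x : E} (hx : x ∈ X) {y y' : ℝ}
    (hy : y ∈ Icc a b) (hy' : y' ∈ Icc a b) (hyy : y ≤ y') :
    C * (y' - y) ≤ (Dy a b (c x) y' + F' y') - (Dy a b (c x) y + F' y) :=
  h.toIsConvexifying.slope_mono h.isOpen h.lt h.one_le h.contDiff hx hy hy' hyy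

theorem slope_nonneg_iff (h : IsArgminMap n X a b c F F' C T) {x : E} (hx : x ∈ X) {y : ℝ}
    (hy : y ∈ Icc a b) : 0 ≤ Dy a b (c x) y + F' y ↔ T x ≤ y := by
  have h0 := h.slope_eq_zero x hx
  constructor
  · intro hle
    by_contra! hlt
    have := h.slope_mono hx hy (h.mem_Icc hx) hlt.le
    nlinarith [h.pos]
  · intro hle
    have := h.slope_mono hx (h.mem_Icc hx) hy hle
    nlinarith [h.pos]

theorem slope_eq_zero_iff (h : IsArgminMap n X a b c F F' C T) {x : E} (hx : x ∈ X) {y : ℝ}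
    (hy : y ∈ Icc a b) : Dy a b (c x) y + F' y = 0 ↔ T x = y := by
  refine ⟨fun h0 => ?_, fun h0 => h0 ▸ h.slope_eq_zero x hx⟩
  refine le_antisymm ((h.slope_nonneg_iff hx hy).1 h0.ge) ?_
  by_contra! hlt
  have := h.slope_mono hx (h.mem_Icc hx) hy hlt.le
  have := h.slope_eq_zero x hx
  nlinarith [h.pos]

theorem hasDerivWithinAt_sum (h : IsArgminMap n X a b c F F' C T) {x : E} (hx : x ∈ X) {y : ℝ}
    (hy : y ∈ Icc a b) :
    HasDerivWithinAt (fun y => c x y + F y) (Dy a b (c x) y + F' y) (Icc a b) y :=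
  ((exists_cost_derivs (by have := h.one_le; omega) h.isOpen h.lt h.contDiff hx).1 y hy).add
    (h.hasDeriv y hy)

/-- Quadratic growth of `c(x, ·) + F` around its minimum point. -/
theorem quadratic_growth (h : IsArgminMap n X a b c F F' C T) {x : E} (hx : x ∈ X) {y : ℝ}
    (hy : y ∈ Icc a b) :
    c x (T x) + F (T x) + C / 2 * (y - T x) ^ 2 ≤ c x y + F y := by
  set t := T x with ht
  have htI := h.mem x hx
  have htI' := h.mem_Icc hx
  have h0 := h.slope_eq_zero x hx
  -- After the parabola is subtracted, `slope_mono` still gives the derivative the sign of `y - t`,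
  -- so the difference is smallest at `t`.
  have hder : ∀ y ∈ Icc a b, HasDerivWithinAt (fun y => c x y + F y - C / 2 * (y - t) ^ 2)
      (Dy a b (c x) y + F' y - C * (y - t)) (Icc a b) y := by
    intro y hy
    have h2 : HasDerivAt (fun y : ℝ => C / 2 * (y - t) ^ 2) (C * (y - t)) y := by
      have := (((hasDerivAt_id y).sub_const t).pow 2).const_mul (C / 2)
      refine this.congr_deriv ?_
      simp only [id_eq, Nat.cast_ofNat]
      ring
    exact (h.hasDerivWithinAt_sum hx hy).sub h2.hasDerivWithinAt
  have hcont : ContinuousOn (fun y => c x y + F y - C / 2 * (y - t) ^ 2) (Icc a b) :=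
    fun y hy => (hder y hy).continuousWithinAt
  have hda : ∀ y ∈ Ioo a b, HasDerivAt (fun y => c x y + F y - C / 2 * (y - t) ^ 2)
      (Dy a b (c x) y + F' y - C * (y - t)) y := fun y hy =>
    (hder y (Ioo_subset_Icc_self hy)).hasDerivAt (Icc_mem_nhds hy.1 hy.2)
  rcases le_total t y with hty | hty
  · have hm : MonotoneOn (fun y => c x y + F y - C / 2 * (y - t) ^ 2) (Icc t b) := by
      refine monotoneOn_of_deriv_nonneg (convex_Icc t b)
        (hcont.mono (Icc_subset_Icc_left htI.1.le)) ?_ ?_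
      · rw [interior_Icc]
        exact fun z hz => (hda z ⟨htI.1.trans hz.1, hz.2⟩).differentiableAt.differentiableWithinAt
      · rw [interior_Icc]
        intro z hz
        have hz' : z ∈ Ioo a b := ⟨htI.1.trans hz.1, hz.2⟩
        rw [(hda z hz').deriv]
        have := h.slope_mono hx htI' (Ioo_subset_Icc_self hz') hz.1.le
        linarith
    have := hm ⟨le_rfl, htI.2.le⟩ ⟨hty, hy.2⟩ hty
    simp only [sub_self] at this
    linarith
  · have hm : AntitoneOn (fun y => c x y + F y - C / 2 * (y - t) ^ 2) (Icc a t) := by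
      refine antitoneOn_of_deriv_nonpos (convex_Icc a t)
        (hcont.mono (Icc_subset_Icc_right htI.2.le)) ?_ ?_
      · rw [interior_Icc]
        exact fun z hz => (hda z ⟨hz.1, hz.2.trans htI.2⟩).differentiableAt.differentiableWithinAt
      · rw [interior_Icc]
        intro z hz
        have hz' : z ∈ Ioo a b := ⟨hz.1, hz.2.trans htI.2⟩
        rw [(hda z hz').deriv]
        have := h.slope_mono hx (Ioo_subset_Icc_self hz') htI' hz.2.le
        linarith
    have := hm ⟨hy.1, hty⟩ ⟨htI.1.le, le_rfl⟩ hty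
    simp only at this
    linarith

theorem min_le (h : IsArgminMap n X a b c F F' C T) {x : E} (hx : x ∈ X) {y : ℝ}
    (hy : y ∈ Icc a b) : c x (T x) + F (T x) ≤ c x y + F y := by
  have := h.quadratic_growth hx hy
  have := h.pos
  nlinarith [mul_nonneg h.pos.le (sq_nonneg (y - T x))]

theorem eq_of_le (h : IsArgminMap n X a b c F F' C T) {x : E} (hx : x ∈ X) {y : ℝ}
    (hy : y ∈ Icc a b) (hle : c x y + F y ≤ c x (T x) + F (T x)) : y = T x := by
  have := h.quadratic_growth hx hy
  have h2 : C / 2 * (y - T x) ^ 2 ≤ 0 := by linarith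
  have h3 : (y - T x) ^ 2 ≤ 0 := by
    have := h.pos
    by_contra! hlt
    nlinarith [mul_pos this hlt]
  exact sub_eq_zero.1 (pow_eq_zero_iff (two_ne_zero)|>.1 (le_antisymm h3 (sq_nonneg _)))

theorem contDiffAt_slope (h : IsArgminMap n X a b c F F' C T) {x : E} (hx : x ∈ X) {y : ℝ}
    (hy : y ∈ Ioo a b) :
    ContDiffAt ℝ n (fun p : E × ℝ => Dy a b (c p.1) p.2 + F' p.2) (x, y) := by
  have h1 := (contDiffOn_Dy_cost h.isOpen h.contDiff).contDiffAt (x := (x, y))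
    ((h.isOpen.prod isOpen_Ioo).mem_nhds ⟨hx, hy⟩)
  have h2 := (h.contDiffOn.contDiffAt (isOpen_Ioo.mem_nhds hy)).comp (x, y)
    (contDiffAt_snd (𝕜 := ℝ) (E := E) (F := ℝ))
  exact h1.add h2

/-- Implicit function theorem for `∂_y c + F' = 0`, whose `y`-derivative is at least `C > 0`. The
local solution agrees with `T` because the zero of the slope is unique. -/
theorem contDiffOn_map [CompleteSpace E] (h : IsArgminMap n X a b c F F' C T) :
    ContDiffOn ℝ n T X := by
  intro x hx
  refine ContDiffAt.contDiffWithinAt ?_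
  have cdf := h.contDiffAt_slope hx (h.mem x hx)
  have pn : (n : WithTop ℕ∞) ≠ 0 := by
    have := h.one_le
    exact_mod_cast (by omega : n ≠ 0)
  set f : E × ℝ → ℝ := fun p => Dy a b (c p.1) p.2 + F' p.2 with hf
  have hline : HasDerivAt (fun t : ℝ => (x, t)) ((0 : E), (1 : ℝ)) (T x) :=
    (hasDerivAt_const _ x).prodMk (hasDerivAt_id _)
  have hd1 : HasDerivAt (fun t => f (x, t)) (fderiv ℝ f (x, T x) (0, 1)) (T x) :=
    HasFDerivAt.comp_hasDerivAt (l := f) (f := fun t : ℝ => (x, t)) (T x)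
      (cdf.differentiableAt pn).hasFDerivAt hline
  have hd2 : HasDerivAt (fun t => f (x, t)) (Dyy a b (c x) (T x) + Dyy a b F (T x)) (T x) :=
    (((exists_cost_derivs (by have := h.one_le; omega) h.isOpen h.lt h.contDiff hx).2 _
      (h.mem_Icc hx)).add (h.hasDeriv_two _ (h.mem_Icc hx))).hasDerivAt
      (Icc_mem_nhds (h.mem x hx).1 (h.mem x hx).2)
  have hne : fderiv ℝ f (x, T x) (0, 1) ≠ 0 := by
    rw [hd1.unique hd2]
    exact (h.pos.trans_le (h.convex x hx _ (h.mem x hx))).ne'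
  have hinv : (fderiv ℝ f (x, T x) ∘L .inr ℝ E ℝ).IsInvertible := by
    refine ⟨ContinuousLinearEquiv.unitsEquivAut ℝ (Units.mk0 _ hne), ?_⟩
    ext
    simp
  have hψ := cdf.contDiffAt_implicitFunction pn hinv
  refine hψ.congr_of_eventuallyEq ?_
  have e1 := cdf.eventually_apply_implicitFunction pn hinv
  have e2 : ∀ᶠ x' in 𝓝 x, cdf.implicitFunction pn hinv x' ∈ Ioo a b := by
    refine hψ.continuousAt.eventually_mem (isOpen_Ioo.mem_nhds ?_)
    have := cdf.implicitFunction_apply_self pn hinv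
    simp only at this
    rw [this]
    exact h.mem x hx
  filter_upwards [e1, e2, h.isOpen.mem_nhds hx] with x' h1 h2 h3
  rw [← h.slope_eq_zero_iff h3 (Ioo_subset_Icc_self h2)]
  exact h1.trans (h.slope_eq_zero x hx)

theorem continuousOn_map [CompleteSpace E] (h : IsArgminMap n X a b c F F' C T) :
    ContinuousOn T X := h.contDiffOn_map.continuousOn

theorem contDiffOn_min [CompleteSpace E] (h : IsArgminMap n X a b c F F' C T) :
    ContDiffOn ℝ n (fun x => c x (T x) + F (T x)) X := by
  have h1 : ContDiffOn ℝ n (fun x => Function.uncurry c (x, T x)) X :=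
    (h.contDiff.1.of_le (by exact_mod_cast Nat.le_succ n)).comp
      (contDiffOn_id.prodMk h.contDiffOn_map) fun x hx => ⟨hx, h.mem x hx⟩
  have h2 : ContDiffOn ℝ n (fun x => F (T x)) X :=
    (h.contDiffOn_self.of_le (by exact_mod_cast Nat.le_succ n)).comp h.contDiffOn_map
      fun x hx => h.mem x hx
  exact h1.add h2

/-- If `DT` vanished at `x`, differentiating `∂_y c(x', T x') + F'(T x') = 0` there would leave only
`D_x ∂_y c(x, T x) = 0`, which non-degeneracy forbids. -/
theorem fderiv_map_ne_zero [CompleteSpace E] (h : IsArgminMap n X a b c F F' C T) {x : E}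
    (hx : x ∈ X) : fderiv ℝ T x ≠ 0 := by
  intro h0
  have pn : (n : WithTop ℕ∞) ≠ 0 := by
    have := h.one_le
    exact_mod_cast (by omega : n ≠ 0)
  have hT : HasFDerivAt T (0 : E →L[ℝ] ℝ) x := by
    rw [← h0]
    exact ((h.contDiffOn_map.contDiffAt (h.isOpen.mem_nhds hx)).differentiableAt pn).hasFDerivAt
  set f : E × ℝ → ℝ := fun p => Dy a b (c p.1) p.2 + F' p.2 with hf
  have hfd : HasFDerivAt f (fderiv ℝ f (x, T x)) (x, T x) :=
    ((h.contDiffAt_slope hx (h.mem x hx)).differentiableAt pn).hasFDerivAt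
  have h1 : HasFDerivAt (fun x' => f (x', T x')) (fderiv ℝ f (x, T x) ∘L .inl ℝ E ℝ) x :=
    HasFDerivAt.comp (g := f) (f := fun x' => (x', T x')) x hfd ((hasFDerivAt_id x).prodMk hT)
  have h2 : HasFDerivAt (fun x' => f (x', T x)) (fderiv ℝ f (x, T x) ∘L .inl ℝ E ℝ) x :=
    HasFDerivAt.comp (g := f) (f := fun x' => (x', T x)) x hfd
      ((hasFDerivAt_id x).prodMk (hasFDerivAt_const _ x))
  have h3 : HasFDerivAt (fun x' => f (x', T x')) (0 : E →L[ℝ] ℝ) x := by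
    refine (hasFDerivAt_const (0 : ℝ) x).congr_of_eventuallyEq ?_
    filter_upwards [h.isOpen.mem_nhds hx] with x' hx' using h.slope_eq_zero x' hx'
  rw [h1.unique h3] at h2
  refine h.nondeg x hx _ (h.mem_Icc hx) ?_
  have : (fun x' => Dy a b (c x') (T x)) = fun x' => f (x', T x) - F' (T x) := by
    funext x'
    simp [hf]
  rw [this]
  exact (h2.sub_const _).fderiv

/-- `T` has no local extremum, so its value at `x` is exceeded from both sides, and the image of a
connected set is an interval. -/
theorem image_mem_nhds [CompleteSpace E] (h : IsArgminMap n X a b c F F' C T)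
    (hconn : IsPreconnected X) {x : E} (hx : x ∈ X) : T '' X ∈ 𝓝 (T x) := by
  have hord : OrdConnected (T '' X) := (hconn.image T h.continuousOn_map).ordConnected
  have h1 : ∃ x₁ ∈ X, T x₁ < T x := by
    by_contra! hcon
    refine h.fderiv_map_ne_zero hx (IsLocalMin.fderiv_eq_zero ?_)
    filter_upwards [h.isOpen.mem_nhds hx] with x' hx' using hcon x' hx'
  have h2 : ∃ x₁ ∈ X, T x < T x₁ := by
    by_contra! hcon
    refine h.fderiv_map_ne_zero hx (IsLocalMax.fderiv_eq_zero ?_)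
    filter_upwards [h.isOpen.mem_nhds hx] with x' hx' using hcon x' hx'
  obtain ⟨x₁, hx₁, hl⟩ := h1
  obtain ⟨x₂, hx₂, hr⟩ := h2
  exact mem_of_superset (Icc_mem_nhds hl hr)
    (hord.out (mem_image_of_mem T hx₁) (mem_image_of_mem T hx₂))

end IsArgminMap

/-! ### The inverse of `g'` and the normalizing constant -/

section Density

variable {g : ℝ → ℝ}

theorem differentiableAt_of_contDiffOn_Ioi (hgC1 : ContDiffOn ℝ 1 g (Ioi 0)) {t : ℝ} (ht : 0 < t) :
    DifferentiableAt ℝ g t :=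
  (hgC1.contDiffAt (Ioi_mem_nhds ht)).differentiableAt (by simp)

theorem tangent_lt (hg : StrictConvexOn ℝ (Ici 0) g) (hgC1 : ContDiffOn ℝ 1 g (Ioi 0)) {s t : ℝ}
    (ht : 0 < t) (hs : 0 ≤ s) (hst : s ≠ t) : g t + deriv g t * (s - t) < g s := by
  have hd := differentiableAt_of_contDiffOn_Ioi hgC1 ht
  rcases lt_or_gt_of_ne hst with h | h
  · have := hg.slope_lt_deriv (x := s) (y := t) hs ht.le h hd
    rw [slope_def_field, div_lt_iff₀ (by linarith)] at this
    linarith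
  · have := hg.deriv_lt_slope (x := t) (y := s) ht.le hs h hd
    rw [slope_def_field, lt_div_iff₀ (by linarith)] at this
    linarith

theorem tangent_le (hg : StrictConvexOn ℝ (Ici 0) g) (hgC1 : ContDiffOn ℝ 1 g (Ioi 0)) {s t : ℝ}
    (ht : 0 < t) (hs : 0 ≤ s) : g t + deriv g t * (s - t) ≤ g s := by
  rcases eq_or_ne s t with rfl | h
  · simp
  · exact (tangent_lt hg hgC1 ht hs h).le

theorem continuousOn_deriv_of_contDiffOn_Ioi (hgC1 : ContDiffOn ℝ 1 g (Ioi 0)) :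
    ContinuousOn (deriv g) (Ioi 0) :=
  hgC1.continuousOn_deriv_of_isOpen isOpen_Ioi le_rfl

theorem strictMonoOn_deriv_of_strictConvexOn (hg : StrictConvexOn ℝ (Ici 0) g)
    (hgC1 : ContDiffOn ℝ 1 g (Ioi 0)) : StrictMonoOn (deriv g) (Ioi 0) :=
  (hg.subset Ioi_subset_Ici_self (convex_Ioi 0)).strictMonoOn_deriv
    fun _ hx => differentiableAt_of_contDiffOn_Ioi hgC1 hx

/-- The tangent line at `t`, evaluated at `0`, lies below `g 0`; hence `g'(t) ≥ (g(t) - |g(0)| t) /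
t` once `t ≥ 1`. -/
theorem tendsto_deriv_atTop (hg : StrictConvexOn ℝ (Ici 0) g) (hgC1 : ContDiffOn ℝ 1 g (Ioi 0))
    (hgsuper : Tendsto (fun t => g t / t) atTop atTop) : Tendsto (deriv g) atTop atTop := by
  have h1 : Tendsto (fun t => g t / t + -|g 0|) atTop atTop :=
    tendsto_atTop_add_const_right _ _ hgsuper
  refine tendsto_atTop_mono' _ ?_ h1
  filter_upwards [eventually_ge_atTop 1] with t ht
  have ht0 : 0 < t := by linarith
  have h := tangent_le hg hgC1 ht0 (le_refl (0 : ℝ))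
  have h2 : g t - |g 0| * t ≤ deriv g t * t := by
    have := le_abs_self (g 0)
    nlinarith [abs_nonneg (g 0)]
  have h3 : g t / t + -|g 0| = (g t - |g 0| * t) / t := by field_simp; ring
  rw [h3, div_le_iff₀ ht0]
  exact h2

/-- The inverse of the derivative of the congestion density. -/
theorem exists_inverse_deriv (hg : StrictConvexOn ℝ (Ici 0) g) (hgC1 : ContDiffOn ℝ 1 g (Ioi 0))
    (hgsuper : Tendsto (fun t => g t / t) atTop atTop)
    (hgzero : Tendsto (deriv g) (𝓝[>] 0) atBot) :
    ∃ φ : ℝ → ℝ, Continuous φ ∧ StrictMono φ ∧ (∀ s, 0 < φ s) ∧ (∀ s, deriv g (φ s) = s) ∧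
      (∀ t, 0 < t → φ (deriv g t) = t) ∧
      ∀ n : ℕ, 1 ≤ n → ContDiffOn ℝ (n + 1 : ℕ) g (Ioi 0) →
        (∀ t, 0 < t → 0 < deriv (deriv g) t) → ContDiff ℝ n φ := by
  -- Composing with `exp` replaces `(0, ∞)` by `ℝ`: `g' ∘ exp` is an order isomorphism of `ℝ`, so
  -- its inverse is continuous and the inverse function theorem applies globally.
  have hmono : StrictMono (fun s => deriv g (Real.exp s)) := fun s t hst =>
    strictMonoOn_deriv_of_strictConvexOn hg hgC1 (Real.exp_pos s) (Real.exp_pos t)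
      (Real.exp_lt_exp.2 hst)
  have hcont : Continuous (fun s => deriv g (Real.exp s)) :=
    (continuousOn_deriv_of_contDiffOn_Ioi hgC1).comp_continuous Real.continuous_exp Real.exp_pos
  have hsurj : Function.Surjective (fun s => deriv g (Real.exp s)) :=
    hcont.surjective ((tendsto_deriv_atTop hg hgC1 hgsuper).comp Real.tendsto_exp_atTop)
      (hgzero.comp Real.tendsto_exp_atBot_nhdsGT)
  set e := hmono.orderIsoOfSurjective _ hsurj with he
  have heapp : ∀ s, e s = deriv g (Real.exp s) := fun s => rfl
  refine ⟨fun s => Real.exp (e.symm s), Real.continuous_exp.comp e.symm.continuous,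
    Real.exp_strictMono.comp e.symm.strictMono, fun s => Real.exp_pos _, fun s => ?_, fun t ht => ?_,
    fun n hn hgn hpos => ?_⟩
  · rw [← heapp, e.apply_symm_apply]
  · have : deriv g t = e (Real.log t) := by rw [heapp, Real.exp_log ht]
    simp only [this, e.symm_apply_apply, Real.exp_log ht]
  · refine Real.contDiff_exp.comp ?_
    have hdg : ContDiffOn ℝ n (deriv g) (Ioi 0) :=
      hgn.deriv_of_isOpen isOpen_Ioi (by exact_mod_cast le_rfl)
    refine e.toHomeomorph.contDiff_symm_deriv
      (f' := fun s => deriv (deriv g) (Real.exp s) * Real.exp s) (fun s => ?_) (fun s => ?_) ?_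
    · exact (mul_pos (hpos _ (Real.exp_pos s)) (Real.exp_pos s)).ne'
    · have h1 : HasDerivAt (deriv g) (deriv (deriv g) (Real.exp s)) (Real.exp s) :=
        ((hdg.contDiffAt (Ioi_mem_nhds (Real.exp_pos s))).differentiableAt
          (by exact_mod_cast (by omega : n ≠ 0))).hasDerivAt
      exact h1.comp s (Real.hasDerivAt_exp s)
    · rw [contDiff_iff_contDiffAt]
      intro s
      exact (hdg.contDiffAt (Ioi_mem_nhds (Real.exp_pos s))).comp s Real.contDiff_exp.contDiffAt

/-- `g` may jump at `0` and is arbitrary on negative numbers, so it is replaced by a measurable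
function with the same values on `[0, ∞)`. -/
theorem aemeasurable_congestion {α : Type*} [MeasurableSpace α] {μ : Measure α}
    (hgC1 : ContDiffOn ℝ 1 g (Ioi 0)) {ρ : α → ℝ} (hρ : AEMeasurable ρ μ)
    (hρ0 : ∀ᵐ x ∂μ, 0 ≤ ρ x) : AEMeasurable (fun x => g (ρ x)) μ := by
  have hm : Measurable ((Ioi (0 : ℝ)).piecewise g fun _ => g 0) :=
    hgC1.continuousOn.measurable_piecewise continuousOn_const measurableSet_Ioi
  refine (hm.comp_aemeasurable hρ).congr ?_
  filter_upwards [hρ0] with x hx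
  rcases hx.eq_or_lt with h | h
  · simp [← h]
  · simp [h]

end Density

section Normalization

variable {E : Type*} [MeasurableSpace E]

/-- Intermediate value theorem in `l`. With `A` the total mass of `κ` and `|U| ≤ M`, the levels
`ψ(1/A) - M` and `ψ(1/A) + M` put the integrand below, respectively above, `1/A`. -/
theorem exists_normalizing_constant {κ : Measure E} [IsFiniteMeasure κ] (hκ : κ ≠ 0) {U : E → ℝ}
    (hU : AEMeasurable U κ) {M : ℝ} (hM : ∀ᵐ x ∂κ, |U x| ≤ M) {φ ψ : ℝ → ℝ} (hφ : Continuous φ)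
    (hmono : StrictMono φ) (hpos : ∀ s, 0 < φ s) (hψ : ∀ t, 0 < t → φ (ψ t) = t) :
    ∃ l, ∫ x, φ (l - U x) ∂κ = 1 := by
  have hmeas : ∀ l, AEStronglyMeasurable (fun x => φ (l - U x)) κ := fun l =>
    (hφ.measurable.comp_aemeasurable (hU.const_sub l)).aestronglyMeasurable
  have hbd : ∀ L l, l ≤ L → ∀ᵐ x ∂κ, ‖φ (l - U x)‖ ≤ φ (L + M) := fun L l hl => by
    filter_upwards [hM] with x hx
    rw [Real.norm_of_nonneg (hpos _).le]
    exact hmono.monotone (by linarith [neg_abs_le (U x)])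
  have hint : ∀ l, Integrable (fun x => φ (l - U x)) κ := fun l =>
    (integrable_const _).mono' (hmeas l) (hbd l l le_rfl)
  have hcont : Continuous fun l => ∫ x, φ (l - U x) ∂κ := by
    rw [continuous_iff_continuousAt]
    intro l
    refine continuousAt_of_dominated (bound := fun _ => φ (l + 1 + M))
      (Eventually.of_forall fun l => hmeas l) ?_ (integrable_const _)
      (Eventually.of_forall fun x => by fun_prop)
    filter_upwards [Iio_mem_nhds (show l < l + 1 by linarith)] with l' hl'
    exact hbd _ _ (le_of_lt hl')
  set A := κ.real univ with hA
  have hApos : 0 < A := by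
    rw [hA, measureReal_def, ENNReal.toReal_pos_iff]
    exact ⟨by simpa [pos_iff_ne_zero] using hκ, measure_lt_top _ _⟩
  have hlow : ∫ x, φ (ψ (1 / A) - M - U x) ∂κ ≤ 1 := by
    calc _ ≤ ∫ _, φ (ψ (1 / A)) ∂κ := integral_mono_ae (hint _) (integrable_const _) (by
          filter_upwards [hM] with x hx
          exact hmono.monotone (by linarith [neg_abs_le (U x)]))
      _ = 1 := by
          rw [hψ _ (by positivity), integral_const, ← hA]
          simp [hApos.ne']
  have hhigh : 1 ≤ ∫ x, φ (ψ (1 / A) + M - U x) ∂κ := by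
    calc 1 = ∫ _, φ (ψ (1 / A)) ∂κ := by
          rw [hψ _ (by positivity), integral_const, ← hA]
          simp [hApos.ne']
      _ ≤ _ := integral_mono_ae (integrable_const _) (hint _) (by
          filter_upwards [hM] with x hx
          exact hmono.monotone (by linarith [le_abs_self (U x)]))
  obtain ⟨l, hl⟩ := mem_range_of_exists_le_of_exists_ge hcont ⟨_, hlow⟩ ⟨_, hhigh⟩
  exact ⟨l, hl⟩

end Normalization

/-! ### Mixtures of measures, couplings and the interaction energy -/

section Mix

variable {α β : Type*} [MeasurableSpace α] [MeasurableSpace β] {μ μ' : Measure α} {t : ℝ}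

/-- The convex combination `(1 - t) μ + t μ'`. -/
noncomputable def mix (t : ℝ) (μ μ' : Measure α) : Measure α :=
  ENNReal.ofReal (1 - t) • μ + ENNReal.ofReal t • μ'

theorem map_mix {f : α → β} (hf : Measurable f) :
    (mix t μ μ').map f = mix t (μ.map f) (μ'.map f) := by
  simp [mix, Measure.map_add _ _ hf, Measure.map_smul]

theorem integral_mix (ht : t ∈ Icc (0 : ℝ) 1) {f : α → ℝ} (hf : Integrable f μ)
    (hf' : Integrable f μ') :
    ∫ x, f x ∂(mix t μ μ') = (1 - t) * ∫ x, f x ∂μ + t * ∫ x, f x ∂μ' := by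
  rw [mix, integral_add_measure (hf.smul_measure ENNReal.ofReal_ne_top)
    (hf'.smul_measure ENNReal.ofReal_ne_top), integral_smul_measure, integral_smul_measure,
    ENNReal.toReal_ofReal (by linarith [ht.2]), ENNReal.toReal_ofReal ht.1, smul_eq_mul,
    smul_eq_mul]

theorem IsProbOn.mix (ht : t ∈ Icc (0 : ℝ) 1) {K : Set α} (h : IsProbOn K μ) (h' : IsProbOn K μ') :
    IsProbOn K (mix t μ μ') := by
  have := h.1
  have := h'.1
  refine ⟨⟨?_⟩, ?_⟩
  · simp only [DoubleMin.mix, Measure.add_apply, Measure.smul_apply, measure_univ, smul_eq_mul, mul_one]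
    rw [← ENNReal.ofReal_add (by linarith [ht.2]) ht.1]
    simp
  · simp [DoubleMin.mix, h.2, h'.2]

theorem mix_withDensity (ht : t ∈ Icc (0 : ℝ) 1) {κ : Measure α} {ρ ρ' : α → ℝ}
    (hρ : Measurable ρ) (h0 : ∀ᵐ x ∂κ, 0 ≤ ρ x)
    (h0' : ∀ᵐ x ∂κ, 0 ≤ ρ' x) :
    mix t (κ.withDensity fun x => ENNReal.ofReal (ρ x))
      (κ.withDensity fun x => ENNReal.ofReal (ρ' x)) =
    κ.withDensity fun x => ENNReal.ofReal ((1 - t) * ρ x + t * ρ' x) := by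
  rw [mix, ← withDensity_smul' _ _ ENNReal.ofReal_ne_top,
    ← withDensity_smul' _ _ ENNReal.ofReal_ne_top,
    ← withDensity_add_left (hρ.ennreal_ofReal.const_smul _)]
  refine withDensity_congr_ae ?_
  filter_upwards [h0, h0'] with x hx hx'
  have ht1 : 0 ≤ 1 - t := by linarith [ht.2]
  simp only [Pi.add_apply, Pi.smul_apply, smul_eq_mul]
  rw [ENNReal.ofReal_add (mul_nonneg ht1 hx) (mul_nonneg ht.1 hx'), ENNReal.ofReal_mul ht1,
    ENNReal.ofReal_mul ht.1]

end Mix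

section Coupling

variable {E : Type*} [MeasurableSpace E] {K : Set E} {a b : ℝ} {μ μ' : Measure E}
  {ν ν' : Measure ℝ} {γ γ' : Measure (E × ℝ)} {c : E → ℝ → ℝ}

theorem mix_mem_couplings {t : ℝ} (hγ : γ ∈ couplings μ ν) (hγ' : γ' ∈ couplings μ' ν') :
    mix t γ γ' ∈ couplings (mix t μ μ') (mix t ν ν') := by
  refine ⟨?_, ?_⟩
  · rw [map_mix measurable_fst, hγ.1, hγ'.1]
  · rw [map_mix measurable_snd, hγ.2, hγ'.2]

theorem isProbabilityMeasure_of_mem_couplings [IsProbabilityMeasure μ] (hγ : γ ∈ couplings μ ν) :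
    IsProbabilityMeasure γ := by
  refine ⟨?_⟩
  rw [← measure_univ (μ := μ), ← hγ.1, Measure.map_apply measurable_fst MeasurableSet.univ]
  simp

theorem ae_fst_of_mem_couplings (hγ : γ ∈ couplings μ ν) {p : E → Prop} (h : ∀ᵐ x ∂μ, p x) :
    ∀ᵐ q ∂γ, p q.1 := by
  rw [← hγ.1] at h
  exact ae_of_ae_map measurable_fst.aemeasurable h

theorem ae_snd_of_mem_couplings (hγ : γ ∈ couplings μ ν) {p : ℝ → Prop} (h : ∀ᵐ y ∂ν, p y) :
    ∀ᵐ q ∂γ, p q.2 := by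
  rw [← hγ.2] at h
  exact ae_of_ae_map measurable_snd.aemeasurable h

theorem integral_fst_of_mem_couplings (hγ : γ ∈ couplings μ ν) {f : E → ℝ} (hf : Integrable f μ) :
    Integrable (fun q => f q.1) γ ∧ ∫ q, f q.1 ∂γ = ∫ x, f x ∂μ := by
  have h1 := hγ.1
  subst h1
  exact ⟨hf.comp_measurable measurable_fst,
    (integral_map measurable_fst.aemeasurable hf.aestronglyMeasurable).symm⟩

theorem integral_snd_of_mem_couplings (hγ : γ ∈ couplings μ ν) {f : ℝ → ℝ} (hf : Integrable f ν) :
    Integrable (fun q => f q.2) γ ∧ ∫ q, f q.2 ∂γ = ∫ y, f y ∂ν := by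
  have h2 := hγ.2
  subst h2
  exact ⟨hf.comp_measurable measurable_snd,
    (integral_map measurable_snd.aemeasurable hf.aestronglyMeasurable).symm⟩

theorem IsProbOn.ae_mem (h : IsProbOn K μ) : ∀ᵐ x ∂μ, x ∈ K := mem_ae_iff.2 h.2

theorem ae_mem_prod_of_mem_couplings (hμ : IsProbOn K μ) (hν : IsProbOn (Icc a b) ν)
    (hγ : γ ∈ couplings μ ν) : ∀ᵐ q ∂γ, q ∈ K ×ˢ Icc a b := by
  filter_upwards [ae_fst_of_mem_couplings hγ hμ.ae_mem, ae_snd_of_mem_couplings hγ hν.ae_mem]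
    with q h1 h2 using ⟨h1, h2⟩

theorem prod_mem_couplings [IsProbabilityMeasure μ] [IsProbabilityMeasure ν] :
    μ.prod ν ∈ couplings μ ν := ⟨by simp, by simp⟩

theorem graph_mem_couplings {T : E → ℝ} (hT : AEMeasurable T μ) :
    μ.map (fun x => (x, T x)) ∈ couplings μ (μ.map T) := by
  have hm : AEMeasurable (fun x => (x, T x)) μ := aemeasurable_id.prodMk hT
  refine ⟨?_, ?_⟩
  · rw [AEMeasurable.map_map_of_aemeasurable measurable_fst.aemeasurable hm]
    exact Measure.map_id
  · rw [AEMeasurable.map_map_of_aemeasurable measurable_snd.aemeasurable hm]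
    rfl

theorem le_transportCost (hμ : IsProbOn K μ)
    (hν : IsProbOn (Icc a b) ν) {B : ℝ} (h : ∀ γ ∈ couplings μ ν, B ≤ ∫ q, c q.1 q.2 ∂γ) :
    B ≤ transportCost c μ ν := by
  have := hμ.1
  have := hν.1
  refine le_csInf ⟨_, _, prod_mem_couplings, rfl⟩ ?_
  rintro _ ⟨η, hη, rfl⟩
  exact h η hη

theorem exists_coupling_lt (hμ : IsProbOn K μ) (hν : IsProbOn (Icc a b) ν) {ε : ℝ} (hε : 0 < ε) :
    ∃ γ ∈ couplings μ ν, ∫ q, c q.1 q.2 ∂γ < transportCost c μ ν + ε := by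
  by_contra! hcon
  have := le_transportCost hμ hν hcon
  linarith

variable [TopologicalSpace E] [BorelSpace E] [T2Space E]

theorem integrable_of_mem_couplings (hK : IsCompact K)
    (hc : ContinuousOn (Function.uncurry c) (K ×ˢ Icc a b)) (hμ : IsProbOn K μ)
    (hν : IsProbOn (Icc a b) ν) (hγ : γ ∈ couplings μ ν) : Integrable (fun q => c q.1 q.2) γ := by
  have := hμ.1
  have := isProbabilityMeasure_of_mem_couplings hγ
  have hr : γ.restrict (K ×ˢ Icc a b) = γ :=
    Measure.restrict_eq_self_of_ae_mem (ae_mem_prod_of_mem_couplings hμ hν hγ)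
  rw [← hr]
  exact hc.integrableOn_compact (hK.prod isCompact_Icc)

theorem transportCost_le (hK : IsCompact K)
    (hc : ContinuousOn (Function.uncurry c) (K ×ˢ Icc a b)) (hμ : IsProbOn K μ)
    (hν : IsProbOn (Icc a b) ν) (hγ : γ ∈ couplings μ ν) :
    transportCost c μ ν ≤ ∫ q, c q.1 q.2 ∂γ := by
  obtain ⟨M, hM⟩ := (hK.prod isCompact_Icc).exists_bound_of_continuousOn hc
  refine csInf_le ⟨-M, ?_⟩ ⟨γ, hγ, rfl⟩
  rintro _ ⟨η, hη, rfl⟩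
  have := hμ.1
  have := isProbabilityMeasure_of_mem_couplings hη
  calc -M = ∫ _, -M ∂η := by simp
    _ ≤ _ := integral_mono_ae (integrable_const _) (integrable_of_mem_couplings hK hc hμ hν hη) (by
      filter_upwards [ae_mem_prod_of_mem_couplings hμ hν hη] with q hq
      exact (abs_le.1 (hM q hq)).1)

/-- Joint convexity of the transport cost: a mixture of couplings couples the mixtures. An
`ε`-optimal plan is used for `(μ, ν)`, so no existence of optimal plans is needed. -/
theorem transportCost_mix_le {t : ℝ} (ht : t ∈ Icc (0 : ℝ) 1) (hK : IsCompact K)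
    (hc : ContinuousOn (Function.uncurry c) (K ×ˢ Icc a b)) (hμ : IsProbOn K μ)
    (hν : IsProbOn (Icc a b) ν) (hμ' : IsProbOn K μ')
    (hν' : IsProbOn (Icc a b) ν') (hγ' : γ' ∈ couplings μ' ν') :
    transportCost c (mix t μ μ') (mix t ν ν') ≤
      (1 - t) * transportCost c μ ν + t * ∫ q, c q.1 q.2 ∂γ' := by
  refine le_of_forall_pos_le_add fun ε hε => ?_
  obtain ⟨γ, hγ, hlt⟩ := exists_coupling_lt (c := c) hμ hν hε
  have h1 := transportCost_le hK hc (hμ.mix ht hμ') (hν.mix ht hν') (mix_mem_couplings hγ hγ')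
  rw [integral_mix ht (integrable_of_mem_couplings hK hc hμ hν hγ)
    (integrable_of_mem_couplings hK hc hμ' hν' hγ')] at h1
  have : 0 ≤ 1 - t := by linarith [ht.2]
  nlinarith [ht.1]

end Coupling

section Interaction

variable {a b : ℝ} {V : ℝ → ℝ} {W : ℝ → ℝ → ℝ} {ν ν' : Measure ℝ}

/-- The energy is a quadratic polynomial in `t`. Symmetry of `W` and Fubini merge the two cross
terms, which is why the linear coefficient is the integral of the first variation without the factor
`1/2`. -/
theorem exists_interactionEnergy_mix (hV : ContinuousOn V (Icc a b))
    (hW : ContinuousOn (Function.uncurry W) (Icc a b ×ˢ Icc a b))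
    (hWsymm : ∀ y ∈ Icc a b, ∀ z ∈ Icc a b, W y z = W z y)
    (hν : IsProbOn (Icc a b) ν) (hν' : IsProbOn (Icc a b) ν') :
    ∃ R : ℝ, ∀ t ∈ Icc (0 : ℝ) 1, interactionEnergy V W (mix t ν ν') = interactionEnergy V W ν +
      t * (∫ y, (V y + ∫ z, W y z ∂ν) ∂ν' - ∫ y, (V y + ∫ z, W y z ∂ν) ∂ν) + t ^ 2 * R := by
  have := hν.1
  have := hν'.1
  have hWt : ContinuousOn (Function.uncurry fun z y => W y z) (Icc a b ×ˢ Icc a b) :=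
    hW.comp (f := Prod.swap) continuous_swap.continuousOn fun p hp => ⟨hp.2, hp.1⟩
  have hA : ContinuousOn (fun y => ∫ z, W y z ∂ν) (Icc a b) := continuousOn_integral_param hν.2 hWt
  have hB : ContinuousOn (fun y => ∫ z, W y z ∂ν') (Icc a b) :=
    continuousOn_integral_param hν'.2 hWt
  have hVi := integrable_of_continuousOn_Icc hν.2 hV
  have hVi' := integrable_of_continuousOn_Icc hν'.2 hV
  have hAi := integrable_of_continuousOn_Icc hν.2 hA
  have hAi' := integrable_of_continuousOn_Icc hν'.2 hA
  have hBi := integrable_of_continuousOn_Icc hν.2 hB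
  have hBi' := integrable_of_continuousOn_Icc hν'.2 hB
  have hsec : ∀ y ∈ Icc a b, ContinuousOn (W y) (Icc a b) := fun y hy =>
    hW.comp (f := fun z => (y, z)) (by fun_prop) fun z hz => ⟨hy, hz⟩
  have hsymm : ∫ y, (∫ z, W y z ∂ν') ∂ν = ∫ y, (∫ z, W y z ∂ν) ∂ν' := by
    have hint : Integrable (Function.uncurry W) (ν.prod ν') :=
      integrable_of_mem_couplings isCompact_Icc hW hν hν' prod_mem_couplings
    rw [integral_integral_swap hint]
    refine integral_congr_ae ?_
    filter_upwards [hν'.ae_mem] with y hy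
    refine integral_congr_ae ?_
    filter_upwards [hν.ae_mem] with z hz using hWsymm z hz y hy
  refine ⟨1 / 2 * (∫ y, (∫ z, W y z ∂ν) ∂ν - 2 * ∫ y, (∫ z, W y z ∂ν) ∂ν' +
    ∫ y, (∫ z, W y z ∂ν') ∂ν'), fun t ht => ?_⟩
  have hinner : ∫ y, (∫ z, W y z ∂(mix t ν ν')) ∂(mix t ν ν') =
      ∫ y, ((1 - t) * ∫ z, W y z ∂ν + t * ∫ z, W y z ∂ν') ∂(mix t ν ν') := by
    refine integral_congr_ae ?_
    filter_upwards [(hν.mix ht hν').ae_mem] with y hy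
    exact integral_mix ht (integrable_of_continuousOn_Icc hν.2 (hsec y hy))
      (integrable_of_continuousOn_Icc hν'.2 (hsec y hy))
  have hAB : Integrable (fun y => (1 - t) * ∫ z, W y z ∂ν + t * ∫ z, W y z ∂ν') ν :=
    (hAi.const_mul _).add (hBi.const_mul _)
  have hAB' : Integrable (fun y => (1 - t) * ∫ z, W y z ∂ν + t * ∫ z, W y z ∂ν') ν' :=
    (hAi'.const_mul _).add (hBi'.const_mul _)
  rw [interactionEnergy, interactionEnergy, hinner, integral_mix ht hVi hVi',
    integral_mix ht hAB hAB', integral_add hVi' hAi', integral_add hVi hAi,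
    integral_add (hAi.const_mul _) (hBi.const_mul _),
    integral_add (hAi'.const_mul _) (hBi'.const_mul _), integral_const_mul, integral_const_mul,
    integral_const_mul, integral_const_mul, hsymm]
  ring

end Interaction

/-! ### Congestion and first order optimality -/

section Congestion

variable {E : Type*} [MeasureSpace E] [SigmaFinite (volume : Measure E)] {g : ℝ → ℝ} {X : Set E}

theorem congestion_withDensity {ρ : E → ℝ} (hρ : AEMeasurable ρ (volume.restrict X))
    (h0 : ∀ᵐ x ∂(volume.restrict X), 0 ≤ ρ x)
    (hint : IntegrableOn (fun x => g (ρ x)) X) :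
    congestion g X ((volume.restrict X).withDensity fun x => ENNReal.ofReal (ρ x)) =
      ((∫ x in X, g (ρ x) : ℝ) : EReal) := by
  have hae : (fun x => g ((((volume.restrict X).withDensity fun x =>
      ENNReal.ofReal (ρ x)).rnDeriv (volume.restrict X) x).toReal)) =ᵐ[volume.restrict X]
      fun x => g (ρ x) := by
    filter_upwards [Measure.rnDeriv_withDensity₀ (volume.restrict X) hρ.ennreal_ofReal, h0]
      with x hx hx0
    rw [hx, ENNReal.toReal_ofReal hx0]
  rw [congestion, if_pos ⟨withDensity_absolutelyContinuous _ _, hint.congr hae.symm⟩,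
    integral_congr_ae hae]

theorem exists_density_of_congestion_ne_top {μ : Measure E} [IsFiniteMeasure μ]
    (h : congestion g X μ ≠ ⊤) :
    ∃ ρ : E → ℝ, Measurable ρ ∧ (∀ x, 0 ≤ ρ x) ∧
      μ = (volume.restrict X).withDensity (fun x => ENNReal.ofReal (ρ x)) ∧
      IntegrableOn (fun x => g (ρ x)) X := by
  have hcond : μ ≪ volume.restrict X ∧
      IntegrableOn (fun x => g ((μ.rnDeriv (volume.restrict X) x).toReal)) X := by
    by_contra hcon
    exact h (if_neg hcon)
  refine ⟨fun x => (μ.rnDeriv (volume.restrict X) x).toReal,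
    (Measure.measurable_rnDeriv _ _).ennreal_toReal, fun x => ENNReal.toReal_nonneg, ?_, hcond.2⟩
  conv_lhs => rw [← Measure.withDensity_rnDeriv_eq _ _ hcond.1]
  refine withDensity_congr_ae ?_
  filter_upwards [Measure.rnDeriv_lt_top μ (volume.restrict X)] with x hx
  rw [ENNReal.ofReal_toReal hx.ne]

end Congestion

theorem ContDiffUpToBoundary.continuousOn_prod_Icc {E : Type*} [NormedAddCommGroup E]
    [NormedSpace ℝ E] {n : ℕ} {X : Set E} {a b : ℝ} (hab : a < b) {c : E → ℝ → ℝ}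
    (hc : ContDiffUpToBoundary n (X ×ˢ Ioo a b) (Function.uncurry c)) :
    ContinuousOn (Function.uncurry c) (closure X ×ˢ Icc a b) := by
  have := hc.2.1
  rwa [closure_prod_eq, closure_Ioo hab.ne] at this

section Variation

variable {m : ℕ} {X : Set (EuclideanSpace ℝ (Fin m))} {a b : ℝ}
  {c : EuclideanSpace ℝ (Fin m) → ℝ → ℝ} {V : ℝ → ℝ} {W : ℝ → ℝ → ℝ} {g : ℝ → ℝ}
  {μ : Measure (EuclideanSpace ℝ (Fin m))} {ν : Measure ℝ}

theorem nonneg_of_forall_quadratic {d R : ℝ} (h : ∀ t ∈ Ioc (0 : ℝ) 1, 0 ≤ t * d + t ^ 2 * R) :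
    0 ≤ d := by
  have h1 : ∀ᶠ t in 𝓝[>] (0 : ℝ), 0 ≤ d + t * R := by
    filter_upwards [Ioc_mem_nhdsGT (zero_lt_one' ℝ)] with t ht
    have := h t ht
    have h2 : t * d + t ^ 2 * R = t * (d + t * R) := by ring
    rw [h2] at this
    exact nonneg_of_mul_nonneg_right this ht.1
  have h2 : Tendsto (fun t : ℝ => d + t * R) (𝓝[>] 0) (𝓝 (d + 0 * R)) :=
    ((continuous_const.add (continuous_id.mul continuous_const)).tendsto 0).mono_left
      nhdsWithin_le_nhds
  have := ge_of_tendsto h2 h1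
  simpa using this

theorem integrable_density {α : Type*} [MeasurableSpace α] {κ : Measure α} {ρ : α → ℝ}
    (hρ : AEMeasurable ρ κ) (h0 : ∀ᵐ x ∂κ, 0 ≤ ρ x)
    [IsProbabilityMeasure (κ.withDensity fun x => ENNReal.ofReal (ρ x))] :
    Integrable ρ κ ∧ ∫ x, ρ x ∂κ = 1 := by
  have h1 : ∫⁻ x, ENNReal.ofReal (ρ x) ∂κ = 1 := by
    have := measure_univ (μ := κ.withDensity fun x => ENNReal.ofReal (ρ x))
    rwa [withDensity_apply _ MeasurableSet.univ, Measure.restrict_univ] at this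
  refine ⟨⟨hρ.aestronglyMeasurable, ?_⟩, ?_⟩
  · rw [hasFiniteIntegral_iff_ofReal h0, h1]
    exact ENNReal.one_lt_top
  · rw [integral_eq_lintegral_of_nonneg_ae h0 hρ.aestronglyMeasurable, h1]
    simp

/-- Convexity squeezes the integrand between the tangent line of `g` at `1` and the chord, both
integrable; the upper bound also gives the inequality. -/
theorem integrable_congestion_mix {α : Type*} [MeasurableSpace α] {κ : Measure α}
    [IsFiniteMeasure κ] (hg : StrictConvexOn ℝ (Ici 0) g) (hgC1 : ContDiffOn ℝ 1 g (Ioi 0))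
    {ρ ρ' : α → ℝ} (hρ : Integrable ρ κ) (hρ' : Integrable ρ' κ) (h0 : ∀ᵐ x ∂κ, 0 ≤ ρ x)
    (h0' : ∀ᵐ x ∂κ, 0 ≤ ρ' x) (hi : Integrable (fun x => g (ρ x)) κ)
    (hi' : Integrable (fun x => g (ρ' x)) κ) {t : ℝ} (ht : t ∈ Icc (0 : ℝ) 1) :
    Integrable (fun x => g ((1 - t) * ρ x + t * ρ' x)) κ ∧
      ∫ x, g ((1 - t) * ρ x + t * ρ' x) ∂κ ≤
        (1 - t) * ∫ x, g (ρ x) ∂κ + t * ∫ x, g (ρ' x) ∂κ := by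
  have ht1 : 0 ≤ 1 - t := by linarith [ht.2]
  have hmeas : AEMeasurable (fun x => (1 - t) * ρ x + t * ρ' x) κ :=
    (hρ.aemeasurable.const_mul _).add (hρ'.aemeasurable.const_mul _)
  have hnn : ∀ᵐ x ∂κ, 0 ≤ (1 - t) * ρ x + t * ρ' x := by
    filter_upwards [h0, h0'] with x hx hx'
    exact add_nonneg (mul_nonneg ht1 hx) (mul_nonneg ht.1 hx')
  have hup : ∀ᵐ x ∂κ, g ((1 - t) * ρ x + t * ρ' x) ≤ (1 - t) * g (ρ x) + t * g (ρ' x) := by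
    filter_upwards [h0, h0'] with x hx hx'
    exact hg.convexOn.2 hx hx' ht1 ht.1 (by ring)
  have hupi : Integrable (fun x => (1 - t) * g (ρ x) + t * g (ρ' x)) κ :=
    (hi.const_mul _).add (hi'.const_mul _)
  have hlow : Integrable (fun x => g 1 + deriv g 1 * ((1 - t) * ρ x + t * ρ' x - 1)) κ :=
    (integrable_const _).add
      ((((hρ.const_mul _).add (hρ'.const_mul _)).sub (integrable_const _)).const_mul _)
  have hint : Integrable (fun x => g ((1 - t) * ρ x + t * ρ' x)) κ := by
    refine integrable_of_le_of_le (aemeasurable_congestion hgC1 hmeas hnn).aestronglyMeasurable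
      ?_ hup hlow hupi
    filter_upwards [hnn] with x hx using tangent_le hg hgC1 one_pos hx
  refine ⟨hint, (integral_mono_ae hint hupi hup).trans_eq ?_⟩
  rw [integral_add (hi.const_mul _) (hi'.const_mul _), integral_const_mul, integral_const_mul]

/-- First order optimality for a minimizer, with the transport cost and the congestion handled by
convexity. -/
theorem IsDoubleMinimizer.exists_density_linearized (hmin : IsDoubleMinimizer c g V W X a b μ ν)
    (hXbdd : Bornology.IsBounded X)
    (hc : ContinuousOn (Function.uncurry c) (closure X ×ˢ Icc a b))
    (hV : ContinuousOn V (Icc a b))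
    (hW : ContinuousOn (Function.uncurry W) (Icc a b ×ˢ Icc a b))
    (hWsymm : ∀ y ∈ Icc a b, ∀ z ∈ Icc a b, W y z = W z y)
    (hg : StrictConvexOn ℝ (Ici 0) g) (hgC1 : ContDiffOn ℝ 1 g (Ioi 0))
    {ρ' : EuclideanSpace ℝ (Fin m) → ℝ} (hρ' : AEMeasurable ρ' (volume.restrict X))
    (h0' : ∀ᵐ x ∂(volume.restrict X), 0 ≤ ρ' x) (hi' : IntegrableOn (fun x => g (ρ' x)) X)
    (hμ' : IsProbOn (closure X)
      ((volume.restrict X).withDensity fun x => ENNReal.ofReal (ρ' x)))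
    {ν' : Measure ℝ} (hν' : IsProbOn (Icc a b) ν')
    {γ' : Measure (EuclideanSpace ℝ (Fin m) × ℝ)}
    (hγ' : γ' ∈ couplings ((volume.restrict X).withDensity fun x => ENNReal.ofReal (ρ' x)) ν') :
    ∃ ρ : EuclideanSpace ℝ (Fin m) → ℝ, Measurable ρ ∧ (∀ x, 0 ≤ ρ x) ∧
      μ = (volume.restrict X).withDensity (fun x => ENNReal.ofReal (ρ x)) ∧
      IntegrableOn (fun x => g (ρ x)) X ∧
      transportCost c μ ν + (∫ x in X, g (ρ x)) + ∫ y, (V y + ∫ z, W y z ∂ν) ∂ν ≤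
        (∫ q, c q.1 q.2 ∂γ') + (∫ x in X, g (ρ' x)) + ∫ y, (V y + ∫ z, W y z ∂ν) ∂ν' := by
  obtain ⟨hμ, hν, hle⟩ := hmin
  have := hμ.1
  have := hμ'.1
  have hK : IsCompact (closure X) := hXbdd.isCompact_closure
  have : IsFiniteMeasure (volume.restrict X) := ⟨by
    simpa using hXbdd.measure_lt_top⟩
  -- The competitor has finite energy, hence so does the minimizer.
  have htop : congestion g X μ ≠ ⊤ := by
    intro htop
    have h := hle _ _ hμ' hν'
    rw [energy, energy, htop, congestion_withDensity hρ' h0' hi', EReal.coe_add_top,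
      EReal.top_add_coe, top_le_iff, ← EReal.coe_add, ← EReal.coe_add] at h
    exact EReal.coe_ne_top _ h
  obtain ⟨ρ, hρ, h0, rfl, hi⟩ := exists_density_of_congestion_ne_top htop
  refine ⟨ρ, hρ, h0, rfl, hi, ?_⟩
  obtain ⟨hρi, -⟩ := integrable_density (κ := volume.restrict X) hρ.aemeasurable (Eventually.of_forall h0)
  obtain ⟨hρi', -⟩ := integrable_density hρ' h0'
  obtain ⟨R, hR⟩ := exists_interactionEnergy_mix hV hW hWsymm hν hν'
  set μ' := (volume.restrict X).withDensity fun x => ENNReal.ofReal (ρ' x) with hμ'def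
  suffices h : 0 ≤ ((∫ q, c q.1 q.2 ∂γ') + (∫ x in X, g (ρ' x)) +
      ∫ y, (V y + ∫ z, W y z ∂ν) ∂ν') - (transportCost c
        ((volume.restrict X).withDensity fun x => ENNReal.ofReal (ρ x)) ν +
      (∫ x in X, g (ρ x)) + ∫ y, (V y + ∫ z, W y z ∂ν) ∂ν) by linarith
  -- Along the mixture, the first two terms lie below their chords by convexity. The interaction
  -- need not be convex, but its deviation from linearity is only `t² R`, which disappears after
  -- division by `t` as `t → 0`.
  refine nonneg_of_forall_quadratic (R := R) fun t ht => ?_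
  have ht' : t ∈ Icc (0 : ℝ) 1 := ⟨ht.1.le, ht.2⟩
  have h := hle _ _ (hμ.mix ht' hμ') (hν.mix ht' hν')
  obtain ⟨hmi, hmle⟩ := integrable_congestion_mix hg hgC1 hρi hρi' (Eventually.of_forall h0) h0'
    hi hi' ht'
  have hTc := transportCost_mix_le ht' hK hc hμ hν hμ' hν' hγ'
  have hnn : ∀ᵐ x ∂(volume.restrict X), 0 ≤ (1 - t) * ρ x + t * ρ' x := by
    filter_upwards [h0'] with x hx'
    exact add_nonneg (mul_nonneg (by linarith [ht.2]) (h0 x)) (mul_nonneg ht.1.le hx')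
  have hcm : congestion g X (mix t ((volume.restrict X).withDensity fun x =>
      ENNReal.ofReal (ρ x)) μ') = ((∫ x in X, g ((1 - t) * ρ x + t * ρ' x) : ℝ) : EReal) := by
    rw [hμ'def, mix_withDensity ht' hρ (Eventually.of_forall h0) h0']
    exact congestion_withDensity
      ((hρi.aemeasurable.const_mul _).add (hρi'.aemeasurable.const_mul _)) hnn hmi
  rw [energy, energy, hcm, congestion_withDensity hρ.aemeasurable (Eventually.of_forall h0) hi,
    hR t ht', ← EReal.coe_add, ← EReal.coe_add, ← EReal.coe_add, ← EReal.coe_add,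
    EReal.coe_le_coe_iff] at h
  linarith

end Variation

/-! ### Duality and identification of the minimizer -/

/-- Quadratic growth controls only `∫ (T x - y)² dγ`; this form of uniform continuity makes that
enough for arbitrary continuous test functions. -/
theorem exists_modulus_quadratic {K : Set ℝ} (hK : IsCompact K) {f : ℝ → ℝ}
    (hf : ContinuousOn f K) {ε : ℝ} (hε : 0 < ε) :
    ∃ A : ℝ, 0 ≤ A ∧ ∀ y ∈ K, ∀ z ∈ K, |f y - f z| ≤ ε + A * (y - z) ^ 2 := by
  obtain ⟨M, hM⟩ := hK.exists_bound_of_continuousOn hf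
  have hu := hK.uniformContinuousOn_of_continuous hf
  rw [Metric.uniformContinuousOn_iff] at hu
  obtain ⟨δ, hδ, hu⟩ := hu ε hε
  refine ⟨2 * |M| / δ ^ 2, by positivity, fun y hy z hz => ?_⟩
  have hA : 0 ≤ 2 * |M| / δ ^ 2 * (y - z) ^ 2 := by positivity
  rcases lt_or_ge |y - z| δ with h | h
  · have := hu y hy z hz (by rwa [Real.dist_eq])
    rw [Real.dist_eq] at this
    linarith
  · have h1 : |f y - f z| ≤ 2 * |M| := by
      have h2 := hM y hy
      have h3 := hM z hz
      rw [Real.norm_eq_abs] at h2 h3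
      have := abs_sub (f y) (f z)
      have := le_abs_self M
      linarith
    have h4 : δ ^ 2 ≤ (y - z) ^ 2 := by
      rw [← sq_abs (y - z)]
      exact pow_le_pow_left₀ hδ.le h 2
    have h5 : 2 * |M| ≤ 2 * |M| / δ ^ 2 * (y - z) ^ 2 := by
      rw [div_mul_eq_mul_div, le_div_iff₀ (by positivity)]
      exact mul_le_mul_of_nonneg_left h4 (by positivity)
    linarith

namespace IsArgminMap

variable {E : Type*} [NormedAddCommGroup E] [NormedSpace ℝ E] {n : ℕ} {X : Set E} {a b : ℝ}
  {c : E → ℝ → ℝ} {F F' : ℝ → ℝ} {C : ℝ} {T : E → ℝ}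

theorem continuousOn_potential (h : IsArgminMap n X a b c F F' C T) : ContinuousOn F (Icc a b) :=
  fun y hy => (h.hasDeriv y hy).continuousWithinAt

theorem continuousOn_cost (h : IsArgminMap n X a b c F F' C T) :
    ContinuousOn (Function.uncurry c) (closure X ×ˢ Icc a b) :=
  h.contDiff.continuousOn_prod_Icc h.lt

theorem exists_bound_min (h : IsArgminMap n X a b c F F' C T) (hK : IsCompact (closure X)) :
    ∃ M, ∀ x ∈ X, |c x (T x) + F (T x)| ≤ M := by
  obtain ⟨M₁, h1⟩ := (hK.prod isCompact_Icc).exists_bound_of_continuousOn h.continuousOn_cost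
  obtain ⟨M₂, h2⟩ := isCompact_Icc.exists_bound_of_continuousOn h.continuousOn_potential
  refine ⟨M₁ + M₂, fun x hx => (abs_add_le _ _).trans (add_le_add ?_ ?_)⟩
  · exact h1 (x, T x) ⟨subset_closure hx, h.mem_Icc hx⟩
  · exact h2 _ (h.mem_Icc hx)

variable [CompleteSpace E] [MeasurableSpace E] [BorelSpace E] {μ : Measure E} {ν : Measure ℝ}

theorem _root_.DoubleMin.aemeasurable_of_continuousOn_of_ae_mem {α β : Type*} [TopologicalSpace α]
    [MeasurableSpace α] [OpensMeasurableSpace α] [TopologicalSpace β] [MeasurableSpace β]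
    [BorelSpace β] {s : Set α} {μ : Measure α} {f : α → β} (hf : ContinuousOn f s)
    (hs : MeasurableSet s) (hμ : ∀ᵐ x ∂μ, x ∈ s) : AEMeasurable f μ := by
  have := hf.aemeasurable (μ := μ) hs
  rwa [Measure.restrict_eq_self_of_ae_mem hμ] at this

theorem aemeasurable_map (h : IsArgminMap n X a b c F F' C T) (hμ : ∀ᵐ x ∂μ, x ∈ X) :
    AEMeasurable T μ :=
  aemeasurable_of_continuousOn_of_ae_mem h.continuousOn_map h.isOpen.measurableSet hμ

theorem aemeasurable_min (h : IsArgminMap n X a b c F F' C T) (hμ : ∀ᵐ x ∂μ, x ∈ X) :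
    AEMeasurable (fun x => c x (T x) + F (T x)) μ :=
  aemeasurable_of_continuousOn_of_ae_mem h.contDiffOn_min.continuousOn h.isOpen.measurableSet hμ

theorem integrable_min (h : IsArgminMap n X a b c F F' C T) (hK : IsCompact (closure X))
    [IsFiniteMeasure μ] (hμ : ∀ᵐ x ∂μ, x ∈ X) :
    Integrable (fun x => c x (T x) + F (T x)) μ := by
  obtain ⟨M, hM⟩ := h.exists_bound_min hK
  refine (integrable_const M).mono' (h.aemeasurable_min hμ).aestronglyMeasurable ?_
  filter_upwards [hμ] with x hx using hM x hx

theorem isProbOn_map (h : IsArgminMap n X a b c F F' C T) (hμ : IsProbOn X μ) :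
    IsProbOn (Icc a b) (μ.map T) := by
  have := hμ.1
  have hT := h.aemeasurable_map hμ.ae_mem
  refine ⟨Measure.isProbabilityMeasure_map hT, ?_⟩
  rw [Measure.map_apply_of_aemeasurable hT measurableSet_Icc.compl]
  exact measure_mono_null (fun x hx hxX => hx (h.mem_Icc hxX)) hμ.2

theorem _root_.DoubleMin.IsProbOn.mono {α : Type*} [MeasurableSpace α] {K K' : Set α}
    {μ : Measure α} (hμ : IsProbOn K μ) (h : K ⊆ K') : IsProbOn K' μ :=
  ⟨hμ.1, measure_mono_null (compl_subset_compl.2 h) hμ.2⟩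

/-- The integrand is the duality gap of the potentials `(U, -F)`. Its integral depends on `γ` only
through the transport cost of the plan. -/
theorem integral_gap (h : IsArgminMap n X a b c F F' C T) (hK : IsCompact (closure X))
    (hμ : IsProbOn X μ) (hν : IsProbOn (Icc a b) ν) {γ : Measure (E × ℝ)}
    (hγ : γ ∈ couplings μ ν) :
    Integrable (fun q => c q.1 q.2 + F q.2 - (c q.1 (T q.1) + F (T q.1))) γ ∧
    ∫ q, (c q.1 q.2 + F q.2 - (c q.1 (T q.1) + F (T q.1))) ∂γ =
      ∫ q, c q.1 q.2 ∂γ + ∫ y, F y ∂ν - ∫ x, (c x (T x) + F (T x)) ∂μ := by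
  have := hμ.1
  have := hν.1
  have h1 := integrable_of_mem_couplings hK h.continuousOn_cost (hμ.mono subset_closure) hν hγ
  obtain ⟨h2, e2⟩ := integral_snd_of_mem_couplings hγ
    (integrable_of_continuousOn_Icc hν.2 h.continuousOn_potential)
  obtain ⟨h3, e3⟩ := integral_fst_of_mem_couplings hγ (h.integrable_min hK hμ.ae_mem)
  have h12 : Integrable (fun q => c q.1 q.2 + F q.2) γ := h1.add h2
  refine ⟨h12.sub h3, ?_⟩
  rw [integral_sub h12 h3, integral_add h1 h2, e2, e3]

/-- Weak duality for `(U, -F)`: the gap is nonnegative almost everywhere for every coupling. -/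
theorem le_transportCost_add (h : IsArgminMap n X a b c F F' C T) (hK : IsCompact (closure X))
    (hμ : IsProbOn X μ) (hν : IsProbOn (Icc a b) ν) :
    ∫ x, (c x (T x) + F (T x)) ∂μ ≤ transportCost c μ ν + ∫ y, F y ∂ν := by
  suffices ∫ x, (c x (T x) + F (T x)) ∂μ - ∫ y, F y ∂ν ≤ transportCost c μ ν by linarith
  refine le_transportCost hμ hν fun γ hγ => ?_
  obtain ⟨-, e⟩ := h.integral_gap hK hμ hν hγ
  have : 0 ≤ ∫ q, (c q.1 q.2 + F q.2 - (c q.1 (T q.1) + F (T q.1))) ∂γ := by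
    refine integral_nonneg_of_ae ?_
    filter_upwards [ae_mem_prod_of_mem_couplings hμ hν hγ] with q hq
    have := h.min_le hq.1 hq.2
    simp only [Pi.zero_apply]
    linarith
  linarith

/-- If the potentials attain the transport cost, then the minimum map transports `μ` to `ν`. -/
theorem map_eq_of_transportCost_add_le (h : IsArgminMap n X a b c F F' C T)
    (hK : IsCompact (closure X)) (hμ : IsProbOn X μ) (hν : IsProbOn (Icc a b) ν)
    (hle : transportCost c μ ν + ∫ y, F y ∂ν ≤ ∫ x, (c x (T x) + F (T x)) ∂μ) :
    μ.map T = ν := by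
  have := hμ.1
  have := hν.1
  have hT := h.aemeasurable_map hμ.ae_mem
  have := (h.isProbOn_map hμ).1
  refine ext_of_forall_integral_eq_of_IsFiniteMeasure fun f => ?_
  rw [integral_map hT f.continuous.aestronglyMeasurable, ← sub_eq_zero]
  refine abs_eq_zero.1 (le_antisymm (le_of_forall_pos_le_add fun ε hε => ?_) (abs_nonneg _))
  obtain ⟨A, hA, hmod⟩ := exists_modulus_quadratic (isCompact_Icc (a := a) (b := b))
    f.continuous.continuousOn (half_pos hε)
  -- Chosen so that `A * (2 / C) * δ ≤ ε / 2`; the `+ 1` covers `A = 0`.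
  set δ := ε * C / (4 * (A + 1)) with hδ
  have hC := h.pos
  have hδpos : 0 < δ := by positivity
  obtain ⟨γ, hγ, hlt⟩ := exists_coupling_lt (c := c) hμ hν hδpos
  have := isProbabilityMeasure_of_mem_couplings hγ
  obtain ⟨hgi, hge⟩ := h.integral_gap hK hμ hν hγ
  have hfT : AEStronglyMeasurable (fun x => f (T x)) μ :=
    (f.continuous.measurable.comp_aemeasurable hT).aestronglyMeasurable
  have hfTi : Integrable (fun x => f (T x)) μ :=
    (integrable_const ‖f‖).mono' hfT (Eventually.of_forall fun x => f.norm_coe_le_norm _)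
  obtain ⟨i1, e1⟩ := integral_fst_of_mem_couplings hγ hfTi
  obtain ⟨i2, e2⟩ := integral_snd_of_mem_couplings hγ (f.integrable ν)
  rw [← e1, ← e2, ← integral_sub i1 i2]
  have hbound : ∀ᵐ q ∂γ, ‖f (T q.1) - f q.2‖ ≤
      ε / 2 + A * (2 / C) * (c q.1 q.2 + F q.2 - (c q.1 (T q.1) + F (T q.1))) := by
    filter_upwards [ae_mem_prod_of_mem_couplings hμ hν hγ] with q hq
    have hq1 := hmod _ (h.mem_Icc hq.1) _ hq.2
    have hq2 := h.quadratic_growth hq.1 hq.2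
    have hq3 : (T q.1 - q.2) ^ 2 ≤
        2 / C * (c q.1 q.2 + F q.2 - (c q.1 (T q.1) + F (T q.1))) := by
      rw [div_mul_eq_mul_div, le_div_iff₀ hC]
      linarith [show (T q.1 - q.2) ^ 2 * C = 2 * (C / 2 * (q.2 - T q.1) ^ 2) by ring]
    have hq4 := mul_le_mul_of_nonneg_left hq3 hA
    rw [Real.norm_eq_abs]
    linarith
  have hb := norm_integral_le_of_norm_le ((integrable_const (ε / 2)).add (hgi.const_mul _)) hbound
  rw [integral_add' (integrable_const _) (hgi.const_mul _), integral_const_mul, hge] at hb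
  simp only [integral_const, probReal_univ, one_smul] at hb
  rw [Real.norm_eq_abs] at hb
  have hfin : A * (2 / C) * (∫ q, c q.1 q.2 ∂γ + ∫ y, F y ∂ν - ∫ x, (c x (T x) + F (T x)) ∂μ) ≤
      A * (2 / C) * δ := mul_le_mul_of_nonneg_left (by linarith) (by positivity)
  have hδ2 : A * (2 / C) * δ ≤ ε / 2 := by
    rw [hδ]
    have : A * (2 / C) * (ε * C / (4 * (A + 1))) = ε / 2 * (A / (A + 1)) := by
      field_simp
      ring
    rw [this]
    have : A / (A + 1) ≤ 1 := (div_le_one (by linarith)).2 (by linarith)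
    nlinarith
  linarith

end IsArgminMap

section

variable {m n : ℕ} {X : Set (EuclideanSpace ℝ (Fin m))} {a b : ℝ}
  {c : EuclideanSpace ℝ (Fin m) → ℝ → ℝ} {V : ℝ → ℝ} {W : ℝ → ℝ → ℝ} {g : ℝ → ℝ}
  {μ : Measure (EuclideanSpace ℝ (Fin m))} {ν : Measure ℝ} {F' : ℝ → ℝ} {C : ℝ}
  {T : EuclideanSpace ℝ (Fin m) → ℝ} {φ : ℝ → ℝ}

theorem integral_withDensity_ofReal {α : Type*} [MeasurableSpace α] {κ : Measure α} {ρ f : α → ℝ}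
    (hρ : AEMeasurable ρ κ) (h0 : ∀ᵐ x ∂κ, 0 ≤ ρ x) :
    ∫ x, f x ∂(κ.withDensity fun x => ENNReal.ofReal (ρ x)) = ∫ x, ρ x * f x ∂κ := by
  rw [integral_withDensity_eq_integral_toReal_smul₀ hρ.ennreal_ofReal
    (Eventually.of_forall fun x => ENNReal.ofReal_lt_top)]
  refine integral_congr_ae ?_
  filter_upwards [h0] with x hx
  rw [ENNReal.toReal_ofReal hx, smul_eq_mul]

/-- The first marginal of a minimizer has density `(g')⁻¹(l - U)`, where `U` is the partial minimum
of `c + F`, and the minimum map transports it to the second marginal. -/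
theorem IsDoubleMinimizer.exists_density_eq (hmin : IsDoubleMinimizer c g V W X a b μ ν)
    (hXbdd : Bornology.IsBounded X) (hXne : X.Nonempty)
    (hV : ContinuousOn V (Icc a b))
    (hW : ContinuousOn (Function.uncurry W) (Icc a b ×ˢ Icc a b))
    (hWsymm : ∀ y ∈ Icc a b, ∀ z ∈ Icc a b, W y z = W z y)
    (hg : StrictConvexOn ℝ (Ici 0) g) (hgC1 : ContDiffOn ℝ 1 g (Ioi 0))
    (h : IsArgminMap n X a b c (fun y => V y + ∫ z, W y z ∂ν) F' C T)
    (hφ : Continuous φ) (hmono : StrictMono φ) (hpos : ∀ s, 0 < φ s)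
    (hφg : ∀ s, deriv g (φ s) = s) (hgφ : ∀ t, 0 < t → φ (deriv g t) = t) :
    ∃ l, μ = (volume.restrict X).withDensity (fun x => ENNReal.ofReal
        (φ (l - (c x (T x) + (V (T x) + ∫ z, W (T x) z ∂ν))))) ∧
      IsProbOn X μ ∧ μ.map T = ν ∧
      transportCost c μ ν + ∫ y, (V y + ∫ z, W y z ∂ν) ∂ν =
        ∫ x, (c x (T x) + (V (T x) + ∫ z, W (T x) z ∂ν)) ∂μ := by
  have hK : IsCompact (closure X) := hXbdd.isCompact_closure
  set κ := volume.restrict X with hκ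
  have hfin : IsFiniteMeasure κ := ⟨by simpa [hκ] using hXbdd.measure_lt_top⟩
  have hκ0 : κ ≠ 0 := by
    rw [hκ, Ne, Measure.restrict_eq_zero]
    exact (h.isOpen.measure_pos _ hXne).ne'
  have hκX : ∀ᵐ x ∂κ, x ∈ X := ae_restrict_mem h.isOpen.measurableSet
  set F : ℝ → ℝ := fun y => V y + ∫ z, W y z ∂ν with hF
  set U : EuclideanSpace ℝ (Fin m) → ℝ := fun x => c x (T x) + F (T x) with hU
  have hUm : AEMeasurable U κ := h.aemeasurable_min hκX
  obtain ⟨M, hM⟩ := h.exists_bound_min hK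
  have hMae : ∀ᵐ x ∂κ, |U x| ≤ M := by
    filter_upwards [hκX] with x hx using hM x hx
  -- The competitor solves `g'(ρ') + U = l`; the constant `l`, the multiplier of the mass
  -- constraint, is fixed by total mass one.
  obtain ⟨l, hl⟩ := exists_normalizing_constant hκ0 hUm hMae hφ hmono hpos hgφ
  set ρ' : EuclideanSpace ℝ (Fin m) → ℝ := fun x => φ (l - U x) with hρ'
  have hρm' : AEMeasurable ρ' κ := hφ.measurable.comp_aemeasurable (hUm.const_sub l)
  have h0' : ∀ᵐ x ∂κ, 0 ≤ ρ' x := Eventually.of_forall fun x => (hpos _).le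
  -- Since `U` is bounded, `ρ'` stays in a compact subset of `(0, ∞)`, where `g` is bounded; this
  -- makes the competitor's congestion finite.
  have hρb' : ∀ᵐ x ∂κ, ρ' x ∈ Icc (φ (l - M)) (φ (l + M)) := by
    filter_upwards [hMae] with x hx
    obtain ⟨h1, h2⟩ := abs_le.1 hx
    exact ⟨hmono.monotone (by linarith), hmono.monotone (by linarith)⟩
  have hρi' : Integrable ρ' κ := by
    refine (integrable_const (φ (l + M))).mono' hρm'.aestronglyMeasurable ?_
    filter_upwards [hρb'] with x hx
    rw [Real.norm_of_nonneg (hpos _).le]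
    exact hx.2
  have hi' : Integrable (fun x => g (ρ' x)) κ := by
    have hcont : ContinuousOn g (Icc (φ (l - M)) (φ (l + M))) :=
      hgC1.continuousOn.mono fun t ht => (hpos _).trans_le ht.1
    obtain ⟨B, hB⟩ := isCompact_Icc.exists_bound_of_continuousOn hcont
    refine (integrable_const B).mono'
      (aemeasurable_congestion hgC1 hρm' h0').aestronglyMeasurable ?_
    filter_upwards [hρb'] with x hx using hB _ hx
  set μ' := κ.withDensity fun x => ENNReal.ofReal (ρ' x) with hμ'
  have hμ'X : IsProbOn X μ' := by
    refine ⟨⟨?_⟩, ?_⟩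
    · rw [hμ', withDensity_apply _ MeasurableSet.univ, Measure.restrict_univ,
        ← ofReal_integral_eq_lintegral_ofReal hρi' h0', hl, ENNReal.ofReal_one]
    · exact withDensity_absolutelyContinuous _ _ (mem_ae_iff.1 hκX)
  have hμ'p := hμ'X.1
  have hT' := h.aemeasurable_map hμ'X.ae_mem
  have hmapT' := h.isProbOn_map hμ'X
  obtain ⟨ρ, hρ, h0, hμ, hi, hineq⟩ := hmin.exists_density_linearized hXbdd h.continuousOn_cost
    hV hW hWsymm hg hgC1 hρm' h0' hi' (hμ'X.mono subset_closure) hmapT'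
    (graph_mem_couplings hT')
  have hν := hmin.2.1
  have hμp := hmin.1.1
  have hνp := hν.1
  have hμX : IsProbOn X μ := by
    refine ⟨hμp, ?_⟩
    rw [hμ]
    exact withDensity_absolutelyContinuous _ _ (mem_ae_iff.1 hκX)
  have hgraph : ∫ q, c q.1 q.2 ∂(μ'.map fun x => (x, T x)) + ∫ y, F y ∂(μ'.map T) =
      ∫ x, U x ∂μ' := by
    have hcoup := graph_mem_couplings hT'
    obtain ⟨-, e⟩ := h.integral_gap hK hμ'X hmapT' hcoup
    have hm : AEMeasurable (fun x => (x, T x)) μ' := aemeasurable_id.prodMk hT'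
    obtain ⟨hi1, -⟩ := h.integral_gap hK hμ'X hmapT' hcoup
    rw [integral_map hm hi1.aestronglyMeasurable] at e
    simp only [sub_self, integral_zero] at e
    linarith
  have hlow := h.le_transportCost_add hK hμX hν
  rw [hμ] at hμp
  obtain ⟨hρi, hρ1⟩ := integrable_density (κ := κ) hρ.aemeasurable (Eventually.of_forall h0)
  rw [← hμ] at hμp
  have hUμ : ∫ x, U x ∂μ = ∫ x, ρ x * U x ∂κ := by
    conv_lhs => rw [hμ]
    exact integral_withDensity_ofReal hρ.aemeasurable (Eventually.of_forall h0)
  have hUμ' : ∫ x, U x ∂μ' = ∫ x, ρ' x * U x ∂κ := integral_withDensity_ofReal hρm' h0'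
  have hUi : ∀ {f : EuclideanSpace ℝ (Fin m) → ℝ}, Integrable f κ →
      Integrable (fun x => f x * U x) κ := fun hf =>
    hf.mul_bdd (c := M) hUm.aestronglyMeasurable (by
      filter_upwards [hMae] with x hx using hx)
  replace hi : Integrable (fun x => g (ρ x)) κ := hi
  have i1 : Integrable (fun x => g (ρ x) - g (ρ' x)) κ := hi.sub hi'
  have i2 : Integrable (fun x => l * ρ x - l * ρ' x) κ := (hρi.const_mul l).sub (hρi'.const_mul l)
  have i3 : Integrable (fun x => ρ x * U x - ρ' x * U x) κ := (hUi hρi).sub (hUi hρi')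
  have i4 : Integrable (fun x => l * ρ x - l * ρ' x - (ρ x * U x - ρ' x * U x)) κ := i2.sub i3
  -- The integrand is the Bregman divergence `g(ρ) - g(ρ') - g'(ρ')(ρ - ρ')` with `g'(ρ') = l - U`.
  -- The terms in `l` cancel because both densities have mass one.
  have e1 : ∫ x, (g (ρ x) - g (ρ' x) - (l * ρ x - l * ρ' x - (ρ x * U x - ρ' x * U x))) ∂κ =
      (∫ x, g (ρ x) ∂κ - ∫ x, g (ρ' x) ∂κ) - ((l * 1 - l * 1) -
        (∫ x, U x ∂μ - ∫ x, U x ∂μ')) := by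
    rw [integral_sub i1 i4, integral_sub hi hi', integral_sub i2 i3,
      integral_sub (hρi.const_mul l) (hρi'.const_mul l), integral_sub (hUi hρi) (hUi hρi'),
      integral_const_mul, integral_const_mul, hρ1, hl, ← hUμ, ← hUμ']
  have hnn : ∀ x, g (ρ' x) + deriv g (ρ' x) * (ρ x - ρ' x) ≤ g (ρ x) := fun x =>
    tangent_le hg hgC1 (hpos _) (h0 x)
  have hd : ∀ x, deriv g (ρ' x) = l - U x := fun x => hφg _
  have hnn' : 0 ≤ fun x =>
      g (ρ x) - g (ρ' x) - (l * ρ x - l * ρ' x - (ρ x * U x - ρ' x * U x)) := by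
    intro x
    have := hnn x
    rw [hd] at this
    simp only [Pi.zero_apply]
    linarith
  have hge0 := integral_nonneg (μ := κ) hnn'
  -- The linearized optimality `hineq`, the value `hgraph` of the competitor and the weak duality
  -- `hlow` together make the divergence nonpositive.
  have hz : ∫ x, (g (ρ x) - g (ρ' x) - (l * ρ x - l * ρ' x - (ρ x * U x - ρ' x * U x))) ∂κ = 0 := by
    refine le_antisymm ?_ hge0
    linarith
  have heq : ρ =ᵐ[κ] ρ' := by
    filter_upwards [(integral_eq_zero_iff_of_nonneg hnn' (i1.sub i4)).1 hz] with x hx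
    by_contra hne
    have := tangent_lt hg hgC1 (hpos _) (h0 x) hne
    rw [hd] at this
    simp only [Pi.zero_apply] at hx
    linarith
  have hμμ' : μ = μ' := by
    rw [hμ, hμ']
    exact withDensity_congr_ae (by filter_upwards [heq] with x hx; rw [hx])
  have hGG : ∫ x, g (ρ x) ∂κ = ∫ x, g (ρ' x) ∂κ :=
    integral_congr_ae (by filter_upwards [heq] with x hx; rw [hx])
  have hle : transportCost c μ ν + ∫ y, F y ∂ν ≤ ∫ x, U x ∂μ := by
    have hUU : ∫ x, U x ∂μ = ∫ x, U x ∂μ' := by rw [hμμ']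
    linarith
  exact ⟨l, hμμ', hμX, h.map_eq_of_transportCost_add_le hK hμX hν hle, le_antisymm hle hlow⟩

end

/-! ### Level sets and null sets of functions without critical points -/

/-- Super-level sets of equal measure of a function without critical points on a connected open
set agree. -/
theorem level_iff_of_measure_eq {E : Type*} [NormedAddCommGroup E] [NormedSpace ℝ E]
    [MeasurableSpace E] [BorelSpace E] {X : Set E} (hX : IsOpen X) (hconn : IsPreconnected X)
    {μ : Measure E} [IsFiniteMeasure μ] (hpos : ∀ O ⊆ X, IsOpen O → μ O = 0 → O = ∅) {f : E → ℝ}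
    (hf : ContinuousOn f X) (hcrit : ∀ x ∈ X, fderiv ℝ f x ≠ 0) {k k' : ℝ}
    (hk : μ {x | x ∈ X ∧ k ≤ f x} = μ {x | x ∈ X ∧ k' ≤ f x}) {x : E} (hx : x ∈ X) :
    (k ≤ f x ↔ k' ≤ f x) ∧ (k < f x ↔ k' < f x) := by
  wlog hlt : k ≤ k' generalizing k k'
  · have := this hk.symm (le_of_not_ge hlt)
    exact ⟨this.1.symm, this.2.symm⟩
  rcases hlt.eq_or_lt with rfl | hlt
  · simp
  -- The open slab between the two levels carries no mass, so it is empty.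
  have hO : IsOpen (X ∩ f ⁻¹' Ioo k k') := hf.isOpen_inter_preimage hX isOpen_Ioo
  have hO0 : μ (X ∩ f ⁻¹' Ioo k k') = 0 := by
    have hdisj : Disjoint (X ∩ f ⁻¹' Ioo k k') {x | x ∈ X ∧ k' ≤ f x} :=
      disjoint_left.2 fun z hz hz' => (not_le.2 hz.2.2) hz'.2
    have hsub : (X ∩ f ⁻¹' Ioo k k') ∪ {x | x ∈ X ∧ k' ≤ f x} ⊆ {x | x ∈ X ∧ k ≤ f x} := by
      rintro z (hz | hz)
      · exact ⟨hz.1, hz.2.1.le⟩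
      · exact ⟨hz.1, hlt.le.trans hz.2⟩
    have h1 := measure_mono (μ := μ) hsub
    rw [measure_union' hdisj hO.measurableSet, hk] at h1
    by_contra h0
    have := ENNReal.lt_add_right (measure_ne_top μ {x | x ∈ X ∧ k' ≤ f x}) h0
    rw [add_comm] at this
    exact absurd h1 (not_le.2 this)
  have hempty := hpos _ inter_subset_left hO hO0
  have hgap : ∀ z ∈ X, f z ≤ k ∨ k' ≤ f z := by
    intro z hz
    by_contra! hcon
    exact (hempty ▸ (⟨hz, hcon⟩ : z ∈ X ∩ f ⁻¹' Ioo k k') : z ∈ (∅ : Set E))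
  have hord : OrdConnected (f '' X) := (hconn.image f hf).ordConnected
  -- As `f(X)` is an interval missing `(k, k')`, it lies on one side of the gap. It cannot touch the
  -- nearer level, which would be an extremal value and hence a critical one.
  rcases hgap x hx with h | h
  · have hall : ∀ z ∈ X, f z ≤ k := by
      intro z hz
      by_contra! hcon
      have hz' := (hgap z hz).resolve_left (not_le.2 hcon)
      obtain ⟨w, hw, hwe⟩ := hord.out (mem_image_of_mem f hx) (mem_image_of_mem f hz)
        (show (k + k') / 2 ∈ Icc (f x) (f z) from ⟨by linarith, by linarith⟩)
      rcases hgap w hw with h1 | h1 <;> linarith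
    have hne : f x < k := by
      refine lt_of_le_of_ne h fun he => hcrit x hx (IsLocalMax.fderiv_eq_zero ?_)
      filter_upwards [hX.mem_nhds hx] with z hz
      rw [he]
      exact hall z hz
    constructor <;> constructor <;> intro h' <;> linarith
  · have hall : ∀ z ∈ X, k' ≤ f z := by
      intro z hz
      by_contra! hcon
      have hz' := (hgap z hz).resolve_right (not_le.2 hcon)
      obtain ⟨w, hw, hwe⟩ := hord.out (mem_image_of_mem f hz) (mem_image_of_mem f hx)
        (show (k + k') / 2 ∈ Icc (f z) (f x) from ⟨by linarith, by linarith⟩)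
      rcases hgap w hw with h1 | h1 <;> linarith
    have hne : k' < f x := by
      refine lt_of_le_of_ne h fun he => hcrit x hx (IsLocalMin.fderiv_eq_zero ?_)
      filter_upwards [hX.mem_nhds hx] with z hz
      rw [← he]
      exact hall z hz
    constructor <;> constructor <;> intro h' <;> linarith

theorem measurableSet_inter_preimage_of_continuousOn {α β : Type*} [TopologicalSpace α]
    [MeasurableSpace α] [OpensMeasurableSpace α] [TopologicalSpace β] [MeasurableSpace β]
    [BorelSpace β] {s : Set α} {f : α → β} {N : Set β} (hf : ContinuousOn f s)
    (hs : MeasurableSet s) (hN : MeasurableSet N) : MeasurableSet (s ∩ f ⁻¹' N) := by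
  have h1 : Measurable (s.domRestrict f) := (continuousOn_iff_continuous_domRestrict.1 hf).measurable
  have h2 : s ∩ f ⁻¹' N = Subtype.val '' (s.domRestrict f ⁻¹' N) := by
    ext x
    simp [and_comm]
  rw [h2]
  exact hs.subtype_image (h1 hN)

/-- One-dimensional change of variables: `f` is injective with derivative at least `δ`, so `δ` times
the measure of the preimage is at most the measure of its image, which lies in `N`. -/
theorem volume_inter_preimage_eq_zero {A : Set ℝ} (hA : Convex ℝ A) (hAo : IsOpen A) {f f' : ℝ → ℝ}
    {δ : ℝ} (hδ : 0 < δ) (hf : ∀ t ∈ A, HasDerivAt f (f' t) t) (hf' : ∀ t ∈ A, δ ≤ f' t)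
    {N : Set ℝ} (hN : MeasurableSet N) (hN0 : volume N = 0) : volume (A ∩ f ⁻¹' N) = 0 := by
  have hcont : ContinuousOn f A := fun t ht => (hf t ht).continuousAt.continuousWithinAt
  have hmono : StrictMonoOn f A := by
    refine strictMonoOn_of_deriv_pos hA hcont fun t ht => ?_
    have ht' := interior_subset ht
    rw [(hf t ht').deriv]
    exact hδ.trans_le (hf' t ht')
  have hm : MeasurableSet (A ∩ f ⁻¹' N) :=
    measurableSet_inter_preimage_of_continuousOn hcont hAo.measurableSet hN
  have key := lintegral_image_eq_lintegral_abs_deriv_mul hm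
    (fun t ht => (hf t ht.1).hasDerivWithinAt) (hmono.injOn.mono inter_subset_left) fun _ => 1
  have h0 : volume (f '' (A ∩ f ⁻¹' N)) = 0 :=
    measure_mono_null (by rintro _ ⟨t, ht, rfl⟩; exact ht.2) hN0
  simp only [lintegral_const, one_mul, mul_one, Measure.restrict_apply_univ, h0] at key
  have h1 : ENNReal.ofReal δ * volume (A ∩ f ⁻¹' N) ≤ 0 := by
    rw [key, ← setLIntegral_const]
    refine setLIntegral_mono' hm fun t ht => ENNReal.ofReal_le_ofReal ?_
    exact (hf' t ht.1).trans (le_abs_self _)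
  rcases mul_eq_zero.1 (le_antisymm h1 (zero_le)) with h | h
  · exact absurd h (by simpa using hδ)
  · exact h

/-- The preimage of a null set under a function without critical points is null. -/
theorem addHaar_inter_preimage_eq_zero {E : Type*} [NormedAddCommGroup E] [NormedSpace ℝ E]
    [FiniteDimensional ℝ E] [MeasurableSpace E] [BorelSpace E] {κ : Measure E}
    [κ.IsAddHaarMeasure] {X : Set E} (hX : IsOpen X) {f : E → ℝ} (hf : ContDiffOn ℝ 1 f X)
    (hcrit : ∀ x ∈ X, fderiv ℝ f x ≠ 0) {N : Set ℝ} (hN : MeasurableSet N) (hN0 : volume N = 0) :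
    κ (X ∩ f ⁻¹' N) = 0 := by
  refine measure_null_of_locally_null _ fun x₀ hx₀ => ?_
  obtain ⟨e, he⟩ : ∃ e, 0 < fderiv ℝ f x₀ e := by
    obtain ⟨e, he⟩ := DFunLike.ne_iff.1 (hcrit x₀ hx₀.1)
    rcases lt_or_gt_of_ne he with h | h
    · exact ⟨-e, by simpa using h⟩
    · exact ⟨e, by simpa using h⟩
  have hcont : ContinuousOn (fun x => fderiv ℝ f x e) X :=
    (hf.continuousOn_fderiv_of_isOpen hX le_rfl).clm_apply continuousOn_const
  set δ := fderiv ℝ f x₀ e / 2 with hδ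
  have hO : IsOpen (X ∩ (fun x => fderiv ℝ f x e) ⁻¹' Ioi δ) :=
    hcont.isOpen_inter_preimage hX isOpen_Ioi
  obtain ⟨r, hr, hball⟩ := Metric.isOpen_iff.1 hO x₀ ⟨hx₀.1, by simp only [mem_preimage, mem_Ioi]; linarith⟩
  refine ⟨Metric.ball x₀ r ∩ f ⁻¹' N, ?_, ?_⟩
  · refine mem_nhdsWithin.2 ⟨Metric.ball x₀ r, Metric.isOpen_ball, Metric.mem_ball_self hr, ?_⟩
    exact fun z hz => ⟨hz.1, hz.2.2⟩
  · have hm : MeasurableSet (Metric.ball x₀ r ∩ f ⁻¹' N) :=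
      measurableSet_inter_preimage_of_continuousOn
        (hf.continuousOn.mono fun z hz => (hball hz).1) Metric.isOpen_ball.measurableSet hN
    -- Fubini along lines in the direction `e`: on the ball, `f` increases at rate at least `δ`
    -- along each line, and a line meets the ball in an interval.
    have := ae_mem_of_ae_add_linearMap_mem (μ := volume) (ν := κ)
      (LinearMap.toSpanSingleton ℝ E e) hm.compl fun y => ?_
    · simpa only [ae_iff, mem_compl_iff, not_not, Set.ofPred_mem_eq] using this
    · set A : Set ℝ := (fun t : ℝ => y + t • e) ⁻¹' Metric.ball x₀ r with hA
      have hAo : IsOpen A := Metric.isOpen_ball.preimage (by fun_prop)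
      have hAc : Convex ℝ A := by
        have : A = (AffineMap.lineMap y (y + e) : ℝ →ᵃ[ℝ] E) ⁻¹' Metric.ball x₀ r := by
          ext t
          simp [hA, AffineMap.lineMap_apply, add_comm]
        rw [this]
        exact (convex_ball x₀ r).affine_preimage _
      have hnull := volume_inter_preimage_eq_zero hAc hAo (f := fun t => f (y + t • e))
        (f' := fun t => fderiv ℝ f (y + t • e) e) (δ := δ) (by linarith) (fun t ht => ?_)
        (fun t ht => le_of_lt (hball ht).2) hN hN0
      · rw [ae_iff]
        refine measure_mono_null (fun t ht => ?_) hnull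
        simpa [hA] using ht
      · have hd : HasFDerivAt f (fderiv ℝ f (y + t • e)) (y + t • e) :=
          ((hf.contDiffAt (hX.mem_nhds (hball ht).1)).differentiableAt one_ne_zero).hasFDerivAt
        have hl : HasDerivAt (fun t : ℝ => y + t • e) e t := by
          simpa using ((hasDerivAt_id t).smul_const e).const_add y
        exact HasFDerivAt.comp_hasDerivAt (l := f) (f := fun t : ℝ => y + t • e) t hd hl

/-! ### Nestedness, optimal maps and Kantorovich potentials -/

namespace IsArgminMap

variable {m n : ℕ} {X : Set (EuclideanSpace ℝ (Fin m))} {a b : ℝ}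
  {c : EuclideanSpace ℝ (Fin m) → ℝ → ℝ} {F F' : ℝ → ℝ} {C : ℝ}
  {T : EuclideanSpace ℝ (Fin m) → ℝ} {μ : Measure (EuclideanSpace ℝ (Fin m))} {ν : Measure ℝ}

theorem superLevelSet_eq (h : IsArgminMap n X a b c F F' C T) {y : ℝ} (hy : y ∈ Icc a b) :
    superLevelSet c X a b y (-F' y) = X ∩ T ⁻¹' Iic y := by
  ext x
  refine and_congr_right fun hx => ?_
  rw [mem_preimage, mem_Iic, ← h.slope_nonneg_iff hx hy]
  constructor <;> intro h' <;> linarith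

theorem measure_Iic_eq (h : IsArgminMap n X a b c F F' C T) (hμ : IsProbOn X μ)
    (hmap : μ.map T = ν) (y : ℝ) : ν (Iic y) = μ (X ∩ T ⁻¹' Iic y) := by
  rw [← hmap, Measure.map_apply_of_aemeasurable (h.aemeasurable_map hμ.ae_mem) measurableSet_Iic]
  refine measure_congr ?_
  filter_upwards [hμ.ae_mem] with x hx
  exact propext ⟨fun h' => ⟨hx, h'⟩, fun h' => h'.2⟩

/-- The levels `-F'(y)` split the mass, since their super-level sets are `{T ≤ y}`. Every other
splitting level cuts `X` identically by `level_iff_of_measure_eq`, so the inclusion reduces to `T x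
≤ y₀ < y₁` implying `T x < y₁`. -/
theorem isNested (h : IsArgminMap n X a b c F F' C T) (hconn : IsPreconnected X)
    (hμ : IsProbOn X μ) (hmap : μ.map T = ν) (hpos : ∀ O ⊆ X, IsOpen O → μ O = 0 → O = ∅) :
    IsNested c X a b μ ν := by
  have := hμ.1
  have hsplit : ∀ y ∈ Ioo a b, IsSplittingLevel c X a b μ ν y (-F' y) := fun y hy => by
    rw [IsSplittingLevel, h.superLevelSet_eq (Ioo_subset_Icc_self hy), h.measure_Iic_eq hμ hmap]
  have hlev : ∀ y ∈ Ioo a b, ∀ k, IsSplittingLevel c X a b μ ν y k → ∀ x ∈ X,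
      (k ≤ Dy a b (c x) y ↔ -F' y ≤ Dy a b (c x) y) ∧
      (k < Dy a b (c x) y ↔ -F' y < Dy a b (c x) y) := by
    intro y hy k hk x hx
    have hcont : ContinuousOn (fun x => Dy a b (c x) y) X :=
      (contDiffOn_Dy_cost h.isOpen h.contDiff).continuousOn.comp (f := fun x => (x, y))
        (by fun_prop) fun x hx => ⟨hx, hy⟩
    exact level_iff_of_measure_eq h.isOpen hconn hpos hcont
      (fun x hx => h.nondeg x hx y (Ioo_subset_Icc_self hy)) (hk.trans (hsplit y hy).symm) hx
  refine ⟨fun y hy => ⟨_, hsplit y hy⟩, fun y₀ hy₀ y₁ hy₁ hlt _ k₀ k₁ hk₀ hk₁ x hx => ?_⟩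
  have hy₀' := Ioo_subset_Icc_self hy₀
  have hy₁' := Ioo_subset_Icc_self hy₁
  have h0 := ((hlev y₀ hy₀ k₀ hk₀ x hx.1).1).1 hx.2
  have hT : T x ≤ y₀ := (h.slope_nonneg_iff hx.1 hy₀').1 (by linarith)
  have h1 : 0 ≤ Dy a b (c x) y₁ + F' y₁ := (h.slope_nonneg_iff hx.1 hy₁').2 (hT.trans hlt.le)
  have h2 : Dy a b (c x) y₁ + F' y₁ ≠ 0 := fun h0 =>
    absurd ((h.slope_eq_zero_iff hx.1 hy₁').1 h0) (hT.trans_lt hlt).ne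
  have h3 : k₁ < Dy a b (c x) y₁ :=
    ((hlev y₁ hy₁ k₁ hk₁ x hx.1).2).2 (by linarith [lt_of_le_of_ne h1 h2.symm])
  exact ⟨⟨hx.1, h3.le⟩, fun h' => h3.ne' h'.2⟩

theorem ae_mem_image (h : IsArgminMap n X a b c F F' C T) (hconn : IsPreconnected X)
    (hμ : IsProbOn X μ) (hmap : μ.map T = ν) : ∀ᵐ y ∂ν, y ∈ T '' X := by
  have hord : OrdConnected (T '' X) := (hconn.image T h.continuousOn_map).ordConnected
  rw [← hmap]
  refine (ae_map_iff (p := fun y => y ∈ T '' X) (h.aemeasurable_map hμ.ae_mem)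
    hord.measurableSet).2 ?_
  filter_upwards [hμ.ae_mem] with x hx using mem_image_of_mem T hx

theorem absolutelyContinuous (h : IsArgminMap n X a b c F F' C T) (hμ : IsProbOn X μ)
    (hmap : μ.map T = ν) (hac : μ ≪ volume) : ν ≪ volume := by
  refine Measure.AbsolutelyContinuous.mk fun N hN hN0 => ?_
  rw [← hmap, Measure.map_apply_of_aemeasurable (h.aemeasurable_map hμ.ae_mem) hN]
  have h1 : (volume : Measure (EuclideanSpace ℝ (Fin m))) (X ∩ T ⁻¹' N) = 0 :=
    addHaar_inter_preimage_eq_zero h.isOpen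
      (h.contDiffOn_map.of_le (by exact_mod_cast h.one_le)) (fun x hx => h.fderiv_map_ne_zero hx)
      hN hN0
  refine measure_mono_null (t := (X ∩ T ⁻¹' N) ∪ Xᶜ) (fun x hx => ?_)
    (measure_union_null (hac h1) hμ.2)
  by_cases hxX : x ∈ X
  · exact Or.inl ⟨hxX, hx⟩
  · exact Or.inr hxX

theorem integral_cost_map (h : IsArgminMap n X a b c F F' C T) (hK : IsCompact (closure X))
    (hμ : IsProbOn X μ) (hν : IsProbOn (Icc a b) ν) (hmap : μ.map T = ν)
    (hopt : transportCost c μ ν + ∫ y, F y ∂ν = ∫ x, (c x (T x) + F (T x)) ∂μ) :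
    Integrable (fun x => c x (T x)) μ ∧ ∫ x, c x (T x) ∂μ = transportCost c μ ν := by
  have := hμ.1
  have := hν.1
  have hT := h.aemeasurable_map hμ.ae_mem
  have hF := integrable_of_continuousOn_Icc hν.2 h.continuousOn_potential
  have hFT : Integrable (fun x => F (T x)) μ := by
    rw [← hmap] at hF
    exact hF.comp_aemeasurable hT
  have hFe : ∫ y, F y ∂ν = ∫ x, F (T x) ∂μ := by
    rw [← hmap] at hF ⊢
    exact integral_map hT hF.aestronglyMeasurable
  have hU := h.integrable_min hK hμ.ae_mem
  have hc : Integrable (fun x => c x (T x)) μ := by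
    refine (hU.sub hFT).congr (Eventually.of_forall fun x => ?_)
    simp
  refine ⟨hc, ?_⟩
  rw [integral_add hc hFT] at hopt
  linarith

theorem isOptimalMap (h : IsArgminMap n X a b c F F' C T) (hK : IsCompact (closure X))
    (hμ : IsProbOn X μ) (hν : IsProbOn (Icc a b) ν) (hmap : μ.map T = ν)
    (hopt : transportCost c μ ν + ∫ y, F y ∂ν = ∫ x, (c x (T x) + F (T x)) ∂μ) :
    IsOptimalMap c μ ν T :=
  ⟨h.aemeasurable_map hμ.ae_mem, hmap, (h.integral_cost_map hK hμ hν hmap hopt).2⟩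

/-- The plan carried by the graph of `S` has zero integrated gap, so `S x` almost surely minimizes
`c(x, ·) + F`, and that minimizer is unique. -/
theorem ae_eq_of_isOptimalMap (h : IsArgminMap n X a b c F F' C T) (hK : IsCompact (closure X))
    (hμ : IsProbOn X μ) (hν : IsProbOn (Icc a b) ν)
    (hopt : transportCost c μ ν + ∫ y, F y ∂ν = ∫ x, (c x (T x) + F (T x)) ∂μ)
    {S : EuclideanSpace ℝ (Fin m) → ℝ} (hS : IsOptimalMap c μ ν S) : S =ᵐ[μ] T := by
  obtain ⟨hSm, hSmap, hSc⟩ := hS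
  have hγ : μ.map (fun x => (x, S x)) ∈ couplings μ ν := hSmap ▸ graph_mem_couplings hSm
  have hm : AEMeasurable (fun x => (x, S x)) μ := aemeasurable_id.prodMk hSm
  obtain ⟨hi, he⟩ := h.integral_gap hK hμ hν hγ
  have hci := integrable_of_mem_couplings hK h.continuousOn_cost (hμ.mono subset_closure) hν hγ
  rw [integral_map hm hci.aestronglyMeasurable, hSc, hopt, sub_self,
    integral_map hm hi.aestronglyMeasurable] at he
  have hi2 : Integrable (fun x => c x (S x) + F (S x) - (c x (T x) + F (T x))) μ :=
    hi.comp_aemeasurable hm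
  have hSI : ∀ᵐ x ∂μ, S x ∈ Icc a b := by
    have := hν.ae_mem
    rw [← hSmap] at this
    exact ae_of_ae_map hSm this
  have hnn : 0 ≤ᵐ[μ] fun x => c x (S x) + F (S x) - (c x (T x) + F (T x)) := by
    filter_upwards [hSI, hμ.ae_mem] with x h1 h2
    exact sub_nonneg.2 (h.min_le h2 h1)
  filter_upwards [(integral_eq_zero_iff_of_nonneg_ae hnn hi2).1 he, hSI, hμ.ae_mem] with x h1 h2 h3
  refine h.eq_of_le h3 h2 ?_
  simp only [Pi.zero_apply] at h1
  linarith

/-- The function `-F` need not be a conjugate away from `T(X)`, so it is replaced by its double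
conjugate `v ≥ -F`. This leaves `u` unchanged and agrees with `-F` on `T(X)`, hence `ν`-almost
everywhere. -/
theorem exists_isKantorovichPair (h : IsArgminMap n X a b c F F' C T)
    (hK : IsCompact (closure X)) (hconn : IsConnected X)
    (hμ : IsProbOn X μ) (hν : IsProbOn (Icc a b) ν) (hmap : μ.map T = ν)
    (hopt : transportCost c μ ν + ∫ y, F y ∂ν = ∫ x, (c x (T x) + F (T x)) ∂μ) :
    ∃ u v, IsKantorovichPair c X a b μ ν u v ∧
      ∫ x, u x ∂μ + ∫ y, v y ∂ν = ∫ x, c x (T x) ∂μ := by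
  have := hμ.1
  have := hν.1
  have hT := h.aemeasurable_map hμ.ae_mem
  obtain ⟨hci, hcT⟩ := h.integral_cost_map hK hμ hν hmap hopt
  set u : EuclideanSpace ℝ (Fin m) → ℝ := fun x => sInf ((fun y => c x y + F y) '' Icc a b)
    with hu_def
  set v : ℝ → ℝ := fun y => sInf ((fun x => c x y - u x) '' closure X) with hv_def
  have hsec : ∀ x ∈ closure X, ContinuousOn (c x) (Icc a b) := fun x hx =>
    h.continuousOn_cost.comp (f := fun y => (x, y)) (by fun_prop) fun y hy => ⟨hx, hy⟩
  have hsec' : ∀ y ∈ Icc a b, ContinuousOn (fun x => c x y) (closure X) := fun y hy =>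
    h.continuousOn_cost.comp (f := fun x => (x, y)) (by fun_prop) fun x hx => ⟨hx, hy⟩
  have hu : ∀ x ∈ closure X, IsLeast ((fun y => c x y + F y) '' Icc a b) (u x) := fun x hx =>
    (isCompact_Icc.image_of_continuousOn ((hsec x hx).add h.continuousOn_potential)).isLeast_sInf
      ((nonempty_Icc.2 h.lt.le).image _)
  have hv : ∀ y ∈ Icc a b, IsLeast ((fun x => c x y - u x) '' closure X) (v y) := by
    intro y hy
    -- As an infimum of continuous functions, `u` is upper semicontinuous; this already suffices for
    -- the minimum to be attained.
    have hlsc : LowerSemicontinuousOn (fun x => c x y - u x) (closure X) := by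
      intro x hx r hr
      obtain ⟨z, hz, hzu⟩ := (hu x hx).1
      have hcont : ContinuousOn (fun x' => c x' y - (c x' z + F z)) (closure X) :=
        (hsec' y hy).sub ((hsec' z hz).add continuousOn_const)
      have hr' : r < c x y - (c x z + F z) := by
        simp only at hzu
        rw [hzu]
        exact hr
      filter_upwards [(hcont x hx).eventually (lt_mem_nhds hr'), self_mem_nhdsWithin] with x' h1 h2
      have := (hu x' h2).2 (mem_image_of_mem _ hz)
      linarith
    obtain ⟨x, hx, hmin⟩ := hlsc.exists_isMinOn hconn.nonempty.closure hK
    have hl : IsLeast ((fun x => c x y - u x) '' closure X) (c x y - u x) := by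
      refine ⟨mem_image_of_mem _ hx, ?_⟩
      rintro _ ⟨z, hz, rfl⟩
      exact hmin hz
    rwa [← hl.csInf_eq] at hl
  have huX : ∀ x ∈ X, u x = c x (T x) + F (T x) := by
    intro x hx
    refine (hu x (subset_closure hx)).unique ⟨mem_image_of_mem _ (h.mem_Icc hx), ?_⟩
    rintro _ ⟨y, hy, rfl⟩
    exact h.min_le hx hy
  have hvF : ∀ y ∈ Icc a b, -F y ≤ v y := by
    intro y hy
    obtain ⟨x, hx, hxv⟩ := (hv y hy).1
    have := (hu x hx).2 (mem_image_of_mem _ hy)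
    simp only at this hxv
    linarith
  have hvT : ∀ x ∈ X, v (T x) = -F (T x) := by
    intro x hx
    refine le_antisymm ?_ (hvF _ (h.mem_Icc hx))
    have := (hv _ (h.mem_Icc hx)).2 (mem_image_of_mem _ (subset_closure hx))
    simp only [huX x hx] at this
    linarith
  have huae : u =ᵐ[μ] fun x => c x (T x) + F (T x) := by
    filter_upwards [hμ.ae_mem] with x hx using huX x hx
  have hvae : v =ᵐ[ν] fun y => -F y := by
    filter_upwards [h.ae_mem_image hconn.isPreconnected hμ hmap] with y hy
    obtain ⟨x, hx, rfl⟩ := hy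
    exact hvT x hx
  have hFi := integrable_of_continuousOn_Icc hν.2 h.continuousOn_potential
  have hval : ∫ x, u x ∂μ + ∫ y, v y ∂ν = ∫ x, c x (T x) ∂μ := by
    rw [integral_congr_ae huae, integral_congr_ae hvae, integral_neg, hcT, ← hopt]
    ring
  refine ⟨u, v, ⟨⟨(h.integrable_min hK hμ.ae_mem).congr huae.symm, hFi.neg.congr hvae.symm, ?_⟩,
    ?_, ?_, hv⟩, hval⟩
  · intro x hx y hy
    have := (hv y hy).2 (mem_image_of_mem _ hx)
    linarith
  · intro u' v' hadm
    obtain ⟨hu'i, hv'i, hle⟩ := hadm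
    have hv'T : Integrable (fun x => v' (T x)) μ := by
      rw [← hmap] at hv'i
      exact hv'i.comp_aemeasurable hT
    have hv'e : ∫ y, v' y ∂ν = ∫ x, v' (T x) ∂μ := by
      rw [← hmap] at hv'i ⊢
      exact integral_map hT hv'i.aestronglyMeasurable
    rw [hval, hv'e, ← integral_add hu'i hv'T]
    refine integral_mono_ae (hu'i.add hv'T) hci ?_
    filter_upwards [hμ.ae_mem] with x hx
    exact hle x (subset_closure hx) _ (h.mem_Icc hx)
  · intro x hx
    refine ⟨?_, ?_⟩
    · obtain ⟨y, hy, hyu⟩ := (hu x hx).1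
      refine ⟨y, hy, ?_⟩
      have h1 := (hv y hy).2 (mem_image_of_mem _ hx)
      have h2 := hvF y hy
      simp only at h1 hyu ⊢
      linarith
    · rintro _ ⟨y, hy, rfl⟩
      have h1 := (hv y hy).2 (mem_image_of_mem _ hx)
      simp only at h1 ⊢
      linarith

/-- Kantorovich potentials saturate the constraint along the whole graph of `T`. -/
theorem eq_of_isKantorovichPair (h : IsArgminMap n X a b c F F' C T)
    (hK : IsCompact (closure X)) (hconn : IsConnected X)
    (hμ : IsProbOn X μ) (hν : IsProbOn (Icc a b) ν) (hmap : μ.map T = ν)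
    (hopt : transportCost c μ ν + ∫ y, F y ∂ν = ∫ x, (c x (T x) + F (T x)) ∂μ)
    (hpos : ∀ O ⊆ X, IsOpen O → μ O = 0 → O = ∅) {u : EuclideanSpace ℝ (Fin m) → ℝ} {v : ℝ → ℝ}
    (huv : IsKantorovichPair c X a b μ ν u v) {x : EuclideanSpace ℝ (Fin m)} (hx : x ∈ X) :
    u x + v (T x) = c x (T x) := by
  have hT := h.aemeasurable_map hμ.ae_mem
  obtain ⟨⟨hui, hvi, hle⟩, hmax, hu, hv⟩ := huv
  obtain ⟨u₀, v₀, ⟨hadm, -⟩, hval⟩ := h.exists_isKantorovichPair hK hconn hμ hν hmap hopt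
  have hge := hmax u₀ v₀ hadm
  obtain ⟨hci, -⟩ := h.integral_cost_map hK hμ hν hmap hopt
  have hvT : Integrable (fun x => v (T x)) μ := by
    rw [← hmap] at hvi
    exact hvi.comp_aemeasurable hT
  have hve : ∫ y, v y ∂ν = ∫ x, v (T x) ∂μ := by
    rw [← hmap] at hvi ⊢
    exact integral_map hT hvi.aestronglyMeasurable
  have huvi : Integrable (fun x => u x + v (T x)) μ := hui.add hvT
  have hnn : 0 ≤ᵐ[μ] fun x => c x (T x) - (u x + v (T x)) := by
    filter_upwards [hμ.ae_mem] with x hx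
    exact sub_nonneg.2 (hle x (subset_closure hx) _ (h.mem_Icc hx))
  have hzero : ∫ x, (c x (T x) - (u x + v (T x))) ∂μ = 0 := by
    refine le_antisymm ?_ (integral_nonneg_of_ae hnn)
    rw [integral_sub hci huvi, integral_add hui hvT, ← hve]
    linarith
  have hae := (integral_eq_zero_iff_of_nonneg_ae hnn (hci.sub huvi)).1 hzero
  refine le_antisymm (hle x (subset_closure hx) _ (h.mem_Icc hx)) ?_
  by_contra! hlt
  -- Freezing the points that attain `u x` and `v (T x)` yields a continuous lower bound for the gap
  -- at nearby `x'`, exact at `x`. If it were positive at `x`, the gap would be positive on a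
  -- nonempty open set, which has positive `μ`-mass. No continuity of `u` or `v` is used.
  obtain ⟨y₀, hy₀, hu0⟩ := (hu x (subset_closure hx)).1
  obtain ⟨x₀, hx₀, hv0⟩ := (hv _ (h.mem_Icc hx)).1
  simp only at hu0 hv0
  have hcont : ContinuousOn (fun x' => c x' (T x') - ((c x' y₀ - v y₀) + (c x₀ (T x') - u x₀))) X := by
    have h1 : ContinuousOn (fun x' => c x' (T x')) X :=
      h.continuousOn_cost.comp (f := fun x' => (x', T x'))
        (continuousOn_id.prodMk h.continuousOn_map) fun x' hx' => ⟨subset_closure hx', h.mem_Icc hx'⟩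
    have h2 : ContinuousOn (fun x' => c x' y₀) X :=
      h.continuousOn_cost.comp (f := fun x' => (x', y₀)) (by fun_prop)
        fun x' hx' => ⟨subset_closure hx', hy₀⟩
    have h3 : ContinuousOn (fun x' => c x₀ (T x')) X :=
      h.continuousOn_cost.comp (f := fun x' => (x₀, T x'))
        (continuousOn_const.prodMk h.continuousOn_map) fun x' hx' => ⟨hx₀, h.mem_Icc hx'⟩
    exact h1.sub ((h2.sub continuousOn_const).add (h3.sub continuousOn_const))
  have hO := hcont.isOpen_inter_preimage h.isOpen isOpen_Ioi (t := Ioi (0 : ℝ))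
  have hempty := hpos _ inter_subset_left hO (by
    refine measure_mono_null (fun x' hx' => ?_) (ae_iff.1 hae)
    have h1 := (hu x' (subset_closure hx'.1)).2 (mem_image_of_mem _ hy₀)
    have h2 := (hv _ (h.mem_Icc hx'.1)).2 (mem_image_of_mem _ hx₀)
    have h3 := hx'.2
    simp only [mem_preimage, mem_Ioi] at h1 h2 h3
    simp only [Pi.zero_apply, mem_ofPred_eq]
    intro h4
    linarith)
  have hmem : x ∈ X ∩ (fun x' => c x' (T x') - ((c x' y₀ - v y₀) + (c x₀ (T x') - u x₀))) ⁻¹'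
      Ioi 0 := by
    refine ⟨hx, ?_⟩
    simp only [mem_preimage, mem_Ioi]
    linarith
  rw [hempty] at hmem
  exact hmem

/-- Any function with the same touching points as the partial minimum differs from it by a
constant. -/
theorem exists_eq_add_const (h : IsArgminMap n X a b c F F' C T) (hconn : IsPreconnected X)
    {u : EuclideanSpace ℝ (Fin m) → ℝ} {v : ℝ → ℝ}
    (hle : ∀ x ∈ X, ∀ y ∈ Icc a b, u x + v y ≤ c x y)
    (heq : ∀ x ∈ X, u x + v (T x) = c x (T x)) :
    ∃ d, ∀ x ∈ X, u x = c x (T x) + F (T x) + d := by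
  set δ : EuclideanSpace ℝ (Fin m) → ℝ := fun x => u x - (c x (T x) + F (T x)) with hδ
  have hder : ∀ x ∈ X, HasFDerivAt δ (0 : EuclideanSpace ℝ (Fin m) →L[ℝ] ℝ) x := by
    intro x hx
    have hnx := h.isOpen.mem_nhds hx
    have hTc : ContinuousAt T x := (h.continuousOn_map x hx).continuousAt hnx
    -- The increments of `u` and of `U` from `x` to `x'` both lie between `c(x', T x') - c(x, T x')`
    -- and `c(x', T x) - c(x, T x)`. Strict differentiability of `c` and continuity of `T` make
    -- these bounds differ by `o(|x' - x|)`, so `u - U` has zero derivative although `u` is not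
    -- known to be differentiable.
    have hs : HasStrictFDerivAt (Function.uncurry c) (fderiv ℝ (Function.uncurry c) (x, T x))
        (x, T x) :=
      (h.contDiff.1.contDiffAt ((h.isOpen.prod isOpen_Ioo).mem_nhds
        ⟨hx, h.mem x hx⟩)).hasStrictFDerivAt (by simp)
    have ho := hs.isLittleO
    have t1 : Tendsto (fun x' => ((x', T x), (x, T x))) (𝓝 x) (𝓝 ((x, T x), (x, T x))) := by
      have : ContinuousAt (fun x' => ((x', T x), (x, T x))) x := by fun_prop
      exact this
    have t2 : Tendsto (fun x' => ((x', T x'), (x, T x'))) (𝓝 x) (𝓝 ((x, T x), (x, T x))) := by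
      have : ContinuousAt (fun x' => ((x', T x'), (x, T x'))) x := by fun_prop
      exact this
    have o1 := ho.comp_tendsto t1
    have o2 := ho.comp_tendsto t2
    simp only [Function.comp_def, Function.uncurry_apply_pair, Prod.mk_sub_mk, sub_self] at o1 o2
    have o3 := o1.sub o2
    have o4 : (fun x' => (x' - x, (0 : ℝ))) =O[𝓝 x] fun x' => x' - x :=
      Asymptotics.isBigO_of_le _ fun x' => by simp [Prod.norm_def]
    have o5 := o3.trans_isBigO o4
    refine HasFDerivAt.of_isLittleO (Asymptotics.IsBigO.trans_isLittleO ?_ o5)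
    refine Asymptotics.IsBigO.of_bound 1 ?_
    filter_upwards [hnx] with x' hx'
    have e1 := heq x hx
    have e2 := heq x' hx'
    have l1 := hle x' hx' _ (h.mem_Icc hx)
    have l2 := hle x hx _ (h.mem_Icc hx')
    have l3 := h.min_le hx' (h.mem_Icc hx)
    have l4 := h.min_le hx (h.mem_Icc hx')
    simp only [hδ, zero_apply, sub_zero, one_mul, Real.norm_eq_abs]
    rw [abs_le]
    have l5 := le_abs_self (c x' (T x) - c x (T x) - fderiv ℝ (Function.uncurry c) (x, T x) (x' - x, 0) -
      (c x' (T x') - c x (T x') - fderiv ℝ (Function.uncurry c) (x, T x) (x' - x, 0)))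
    constructor <;> linarith
  obtain ⟨d, hd⟩ := h.isOpen.exists_is_const_of_fderiv_eq_zero hconn
    (fun x hx => (hder x hx).differentiableAt.differentiableWithinAt) fun x hx => (hder x hx).fderiv
  refine ⟨d, fun x hx => ?_⟩
  have := hd x hx
  simp only [hδ] at this
  linarith

theorem isGenNested_and_contDiffOn (h : IsArgminMap n X a b c F F' C T)
    (hK : IsCompact (closure X)) (hconn : IsConnected X)
    (hμ : IsProbOn X μ) (hν : IsProbOn (Icc a b) ν) (hmap : μ.map T = ν)
    (hopt : transportCost c μ ν + ∫ y, F y ∂ν = ∫ x, (c x (T x) + F (T x)) ∂μ)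
    (hpos : ∀ O ⊆ X, IsOpen O → μ O = 0 → O = ∅) {u : EuclideanSpace ℝ (Fin m) → ℝ} {v : ℝ → ℝ}
    (huv : IsKantorovichPair c X a b μ ν u v) :
    IsGenNested c X a b ν u v ∧ ContDiffOn ℝ n u X := by
  have heq : ∀ x ∈ X, u x + v (T x) = c x (T x) := fun x hx =>
    h.eq_of_isKantorovichPair hK hconn hμ hν hmap hopt hpos huv hx
  obtain ⟨d, hd⟩ := h.exists_eq_add_const hconn.isPreconnected
    (fun x hx y hy => huv.1.2.2 x (subset_closure hx) y hy) heq
  have hvF : ∀ y ∈ T '' X, v y = -F y - d := by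
    rintro _ ⟨x, hx, rfl⟩
    linarith [heq x hx, hd x hx]
  refine ⟨?_, (h.contDiffOn_min.add contDiffOn_const).congr hd⟩
  filter_upwards [h.ae_mem_image hconn.isPreconnected hμ hmap] with y hy
  -- The formula for `v` holds only on `T(X)`; openness of that image is what lets it be
  -- differentiated at `y`.
  have hyn : T '' X ∈ 𝓝 y := by
    obtain ⟨x, hx, rfl⟩ := hy
    exact h.image_mem_nhds hconn.isPreconnected hx
  have hyI : y ∈ Icc a b := by
    obtain ⟨x, hx, rfl⟩ := hy
    exact h.mem_Icc hx
  have hder : HasDerivWithinAt v (-F' y) (Icc a b) y := by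
    refine (((h.hasDeriv y hyI).neg).sub_const d).congr_of_eventuallyEq ?_ (hvF y hy)
    filter_upwards [mem_nhdsWithin_of_mem_nhds hyn] with z hz using hvF z hz
  refine ⟨hder.differentiableWithinAt, ?_⟩
  rw [Dy_eq h.lt hder hyI]
  ext x
  refine and_congr_right fun hx => ?_
  rw [hd x hx, hvF y hy]
  constructor
  · intro he
    have := (h.slope_eq_zero_iff hx hyI).2 (h.eq_of_le hx hyI (by linarith)).symm
    linarith
  · intro he
    have := (h.slope_eq_zero_iff hx hyI).1 (by linarith)
    rw [← this]
    ring

end IsArgminMap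

end DoubleMin

/-! ### The main theorem -/

theorem mainTheorem11 (m k : ℕ) (hm : 1 < m)
    -- the domains `X ⊆ ℝ^m` and `Y = (a, b)`
    (X : Set (EuclideanSpace ℝ (Fin m))) (hXopen : IsOpen X) (hXconn : IsConnected X)
    (hXbdd : Bornology.IsBounded X) (a b : ℝ) (hab : a < b)
    -- the cost, the potential, the interaction and the congestion density
    (c : EuclideanSpace ℝ (Fin m) → ℝ → ℝ) (V : ℝ → ℝ) (W : ℝ → ℝ → ℝ) (g : ℝ → ℝ)
    -- `c`, `V`, `W` are of class `C^(k+2)` up to the boundary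
    (hc : DoubleMin.ContDiffUpToBoundary (k + 2) (X ×ˢ Ioo a b) (Function.uncurry c))
    (hV : DoubleMin.ContDiffUpToBoundary (k + 2) (Ioo a b) V)
    (hW : DoubleMin.ContDiffUpToBoundary (k + 2) (Ioo a b ×ˢ Ioo a b) (Function.uncurry W))
    (hWsymm : ∀ y ∈ Icc a b, ∀ z ∈ Icc a b, W y z = W z y)
    -- twist
    (htwist : ∀ x ∈ X, InjOn (fun y => fderiv ℝ (fun x' => c x' y) x) (Ioo a b))
    -- non-degeneracy
    (hnondeg : ∀ x ∈ X, ∀ y ∈ Icc a b,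
      fderiv ℝ (fun x' => DoubleMin.Dy a b (c x') y) x ≠ 0)
    -- uniform convexity
    (hconv : ∃ C : ℝ, 0 < C ∧ ∀ x ∈ X, ∀ y ∈ Ioo a b, ∀ z ∈ Ioo a b,
      C ≤ DoubleMin.Dyy a b (c x) y + DoubleMin.Dyy a b V y
        + DoubleMin.Dyy a b (fun y' => W y' z) y)
    -- outward gradient at the two boundary points of `Y`
    (hright : ∀ x ∈ X, ∀ z ∈ Ioo a b,
      0 ≤ DoubleMin.Dy a b (c x) b + DoubleMin.Dy a b V b
        + DoubleMin.Dy a b (fun y' => W y' z) b)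
    (hleft : ∀ x ∈ X, ∀ z ∈ Ioo a b,
      DoubleMin.Dy a b (c x) a + DoubleMin.Dy a b V a
        + DoubleMin.Dy a b (fun y' => W y' z) a ≤ 0)
    -- the congestion density
    (hgconv : StrictConvexOn ℝ (Ici 0) g) (hgC1 : ContDiffOn ℝ 1 g (Ioi 0))
    (hgsuper : Tendsto (fun t => g t / t) atTop atTop)
    (hgzero : Tendsto (deriv g) (𝓝[>] 0) atBot)
    -- a minimizer
    (μ : Measure (EuclideanSpace ℝ (Fin m))) (ν : Measure ℝ)
    (hmin : DoubleMin.IsDoubleMinimizer c g V W X a b μ ν) :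
    -- nestedness
    DoubleMin.IsNested c X a b μ ν ∧
    -- Kantorovich potentials: existence, generalized nestedness, regularity of `u`
    (∃ u v, DoubleMin.IsKantorovichPair c X a b μ ν u v) ∧
    (∀ u v, DoubleMin.IsKantorovichPair c X a b μ ν u v →
      DoubleMin.IsGenNested c X a b ν u v ∧ ContDiffOn ℝ ((k + 1 : ℕ) : WithTop ℕ∞) u X) ∧
    -- `μ` has an everywhere positive density, which is as regular as `u`
    (∃ ρ : EuclideanSpace ℝ (Fin m) → ℝ,
      (∀ x ∈ X, 0 < ρ x) ∧ ContinuousOn ρ X ∧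
      μ = (volume.restrict X).withDensity (fun x => ENNReal.ofReal (ρ x)) ∧
      ContDiffOn ℝ ((k + 1 : ℕ) : WithTop ℕ∞) (fun x => deriv g (ρ x)) X ∧
      (ContDiffOn ℝ ((k + 2 : ℕ) : WithTop ℕ∞) g (Ioi 0) → (∀ t, 0 < t → 0 < deriv (deriv g) t) →
        ContDiffOn ℝ ((k + 1 : ℕ) : WithTop ℕ∞) ρ X)) ∧
    -- the optimal map and its regularity
    (∃ T : EuclideanSpace ℝ (Fin m) → ℝ,
      MapsTo T X (Icc a b) ∧ DoubleMin.IsOptimalMap c μ ν T ∧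
      (∀ T', DoubleMin.IsOptimalMap c μ ν T' → T' =ᵐ[μ] T) ∧
      ContDiffOn ℝ k T X) ∧
    -- `ν` is absolutely continuous
    ν ≪ volume := by
  have hK : IsCompact (closure X) := hXbdd.isCompact_closure
  have hWc : ContinuousOn (Function.uncurry W) (Icc a b ×ˢ Icc a b) := by
    have := hW.continuousOn_prod_Icc hab
    rwa [closure_Ioo hab.ne] at this
  have hVc : ContinuousOn V (Icc a b) := by
    have := hV.2.1
    rwa [closure_Ioo hab.ne] at this
  have hν := hmin.2.1
  have hνp := hν.1
  obtain ⟨C, hC, hconv⟩ := hconv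
  -- Here `r = k + 2` and `n = k + 1 = r - 1`: one derivative is spent on the slope `∂_y c + F'`.
  -- The map `T` comes out of class `C^(r-1)`, which is more than the asserted `C^(r-2)`.
  obtain ⟨F', hF⟩ := DoubleMin.exists_isConvexifying_firstVariation (n := k + 1) (by omega) hab hV hW
    hWsymm hC hconv hright hleft hν.2
  obtain ⟨T, hT⟩ := hF.exists_argmin hXopen hab (by omega) hc hnondeg
  have h : DoubleMin.IsArgminMap (k + 1) X a b c (fun y => V y + ∫ z, W y z ∂ν) F' C T :=
    { toIsConvexifying := hF
      isOpen := hXopen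
      lt := hab
      one_le := by omega
      contDiff := hc
      nondeg := hnondeg
      mem := fun x hx => (hT x hx).1
      slope_eq_zero := fun x hx => (hT x hx).2 }
  obtain ⟨φ, hφ, hmono, hφpos, hφg, hgφ, hφreg⟩ :=
    DoubleMin.exists_inverse_deriv hgconv hgC1 hgsuper hgzero
  obtain ⟨l, hμ, hμX, hmap, hopt⟩ := hmin.exists_density_eq hXbdd hXconn.nonempty hVc hWc hWsymm
    hgconv hgC1 h hφ hmono hφpos hφg hgφ
  have hU : ContDiffOn ℝ ((k + 1 : ℕ) : WithTop ℕ∞)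
      (fun x => l - (c x (T x) + (V (T x) + ∫ z, W (T x) z ∂ν))) X :=
    contDiffOn_const.sub h.contDiffOn_min
  have hρc : ContinuousOn (fun x => φ (l - (c x (T x) + (V (T x) + ∫ z, W (T x) z ∂ν)))) X :=
    hφ.comp_continuousOn hU.continuousOn
  -- Everywhere positivity of the density enters the nestedness and potential arguments in this
  -- form: `μ` charges every nonempty open subset of `X`.
  have hpos : ∀ O ⊆ X, IsOpen O → μ O = 0 → O = ∅ := by
    intro O hOX hO hO0
    rw [hμ, withDensity_apply _ hO.measurableSet, Measure.restrict_restrict hO.measurableSet,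
      inter_eq_left.2 hOX, lintegral_eq_zero_iff'
        ((hρc.mono hOX).aemeasurable hO.measurableSet).ennreal_ofReal] at hO0
    have hfalse : ∀ᵐ x ∂(volume.restrict O), False := by
      filter_upwards [hO0] with x hx
      simp only [Pi.zero_apply, ENNReal.ofReal_eq_zero] at hx
      exact absurd hx (not_le.2 (hφpos _))
    rw [eventually_false_iff_eq_bot, ae_eq_bot, Measure.restrict_eq_zero] at hfalse
    exact hO.measure_eq_zero_iff _ |>.1 hfalse
  have hac : μ ≪ volume := by
    rw [hμ]
    exact (withDensity_absolutelyContinuous _ _).trans Measure.restrict_le_self.absolutelyContinuous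
  refine ⟨h.isNested hXconn.isPreconnected hμX hmap hpos, ?_, fun u v huv =>
    h.isGenNested_and_contDiffOn hK hXconn hμX hν hmap hopt hpos huv,
    ⟨_, fun x _ => hφpos _, hρc, hμ, ?_, fun hg hg2 => ?_⟩,
    ⟨T, fun x hx => h.mem_Icc hx, h.isOptimalMap hK hμX hν hmap hopt,
      fun S hS => h.ae_eq_of_isOptimalMap hK hμX hν hopt hS,
      h.contDiffOn_map.of_le (by exact_mod_cast Nat.le_succ k)⟩,
    h.absolutelyContinuous hμX hmap hac⟩
  · obtain ⟨u, v, huv, -⟩ := h.exists_isKantorovichPair hK hXconn hμX hν hmap hopt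
    exact ⟨u, v, huv⟩
  · simpa only [hφg] using hU
  · exact (hφreg (k + 1) (by omega) hg hg2).comp_contDiffOn hU
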